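/- Let $p\in(1,2)$ and let $u_0\in C^2([0,1])$ be real-valued with $u_0>0$ on $[0,1]$ and $u_0'(0)=0$. For real $r,u,w$ put $j=\dfrac{4(u+rw)^2+4u^2}{(1+r^2u^2)^2}$ and $$a(r,u,w)=j^{\frac{p-4}{2}}\,\frac{4(p-1)(u+rw)^2+4u^2}{(1+r^2u^2)^2},\qquad b(r,u,w)=j^{\frac{p-4}{2}}\,\frac{12pu^2}{(1+r^2u^2)^3},$$ $$f(r,u,w)=\frac{4\,j^{\frac{p-4}{2}}}{(1+r^2u^2)^3}\Big[2(1-p)r^4uw^4-rw^3\big((6p-7)r^2u^2-2p+1\big)-uw^2\big(3(3p-4)r^2u^2-5p+4\big)-(9p-16)ru^4w+4(2-p)u^5\Big],$$ so that $u_t=a(r,u,u_r)u_{rr}+\frac{b(r,u,u_r)}{r}u_r+f(r,u,u_r)$ is the equation satisfied by $u$ when $h=2\arctan(ru)$ solves the rotationally symmetric $p$-harmonic flow $$h_t=\Big(h_r^2+\tfrac{\sin^2h}{r^2}\Big)^{\frac{p-4}{2}}\Big[(p-1)h_r^2h_{rr}+(p-3)\Big(\tfrac{h_r^2\sin h\cos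 h}{r^2}-\tfrac{h_r\sin^2h}{r^3}\Big)+\tfrac{h_r^3}{r}+\tfrac{h_{rr}\sin^2h}{r^2}-\tfrac{\sin^3h\cos h}{r^4}\Big].$$ Let $$Lv=a\,v''+\frac{b}{r}\,v'+c\,v'+d\,v$$ be the linearization at $u_0$ of the right-hand side of the equation for $u$, where $a,b$ and the partial derivatives of $a,b,f$ are evaluated at $(r,u_0(r),u_0'(r))$, $$c=\frac{\partial a}{\partial w}u_0''+\frac{\partial b}{\partial w}\frac{u_0'}{r}+\frac{\partial f}{\partial w},\qquad d=\frac{\partial a}{\partial u}u_0''+\frac{\partial b}{\partial u}\frac{u_0'}{r}+\frac{\partial f}{\partial u},$$ and the quotients $u_0'/r$, $v'/r$ are given their limits $u_0''(0)$, $v''(0)$ at $r=0$. Then $L$, with domain $D(L)=\{v\in C^2([0,1];\mathbb C):v'(0)=v(1)=0\}$, is sectorial in $X=C([0,1];\mathbb C)$; that is, there are $\omega\in\mathbb R$, $\theta\in(\pi/2,\pi)$ and $K>0$ such that every $\lambda\neq\omega$ with $|\arg(\lambda-\omega)|<\theta$ is in the resolvent set of $L$ and $\|(\lambda-L)^{-1}\|\le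 K/|\lambda-\omega|$. In addition there is a constant $C=C(M)>1$, depending only on $$M=(\inf a)^{-1}+(\inf b)^{-1}+\|a\|_\infty+\|b\|_\infty+\|c\|_\infty+\|d\|_\infty$$ (infima and sup norms over $r\in[0,1]$), such that for all $v\in D(L)$ and all $\lambda\in\mathbb C$ with $\mathrm{Re}\,\lambda\ge C(M)$ $$|\lambda|\,\|v\|_\infty+|\lambda|^{1/2}\|v'\|_\infty+\|v''\|_\infty\le C(M)\,\|(\lambda-L)v\|_\infty .$$ -/

import Mathlib

noncomputable section

namespace PHarmonicFlow

open Set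

/-! ### Sectorial operators -/

section Sectorial

variable {X : Type*} [NormedAddCommGroup X] [NormedSpace ℂ X]

/-- `R` is the resolvent operator `(z - A)⁻¹` of the (possibly unbounded) operator `A`:
a bounded operator with values in `D(A)` that is a two-sided inverse of `z - A : D(A) → X`. -/
def IsResolvent (A : X →ₗ.[ℂ] X) (z : ℂ) (R : X →L[ℂ] X) : Prop :=
  (∀ x : X, ∃ h : R x ∈ A.domain, z • R x - A ⟨R x, h⟩ = x) ∧
    ∀ v : A.domain, R (z • (v : X) - A v) = v

/-- A linear operator `A : D(A) ⊆ X → X` is sectorial if there are `ω ∈ ℝ`, `θ ∈ (π/2, π)`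
and `K > 0` such that every `z` in the sector `z ≠ ω`, `|arg (z - ω)| < θ` belongs to the
resolvent set of `A`, and `‖(z - A)⁻¹‖ ≤ K / |z - ω|` there. -/
def IsSectorial (A : X →ₗ.[ℂ] X) : Prop :=
  ∃ ω θ K : ℝ, Real.pi / 2 < θ ∧ θ < Real.pi ∧ 0 < K ∧
    ∀ z : ℂ, z ≠ (ω : ℂ) → |Complex.arg (z - ω)| < θ →
      ∃ R : X →L[ℂ] X, IsResolvent A z R ∧ ‖R‖ ≤ K / ‖z - ω‖

end Sectorial

/-! ### Functions of class `C²` on `[0,1]` -/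

section Deriv

variable {E : Type*} [NormedAddCommGroup E] [NormedSpace ℝ E]

/-- The derivative on `[0,1]`, one-sided at the endpoints. -/
def D1 (u : ℝ → E) : ℝ → E := derivWithin u (Icc 0 1)

/-- The second derivative on `[0,1]`, one-sided at the endpoints. -/
def D2 (u : ℝ → E) : ℝ → E := derivWithin (D1 u) (Icc 0 1)

/-- The quotient `u'(r) / r` on `[0,1]`, with the value `u''(0)` at `r = 0`, which is its limit
for `r → 0+` when `u` is of class `C²` and `u'(0) = 0`. -/
def DQ (u : ℝ → E) (r : ℝ) : E := if r = 0 then D2 u 0 else r⁻¹ • D1 u r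

theorem contDiffOn_D1 {u : ℝ → E} (hu : ContDiffOn ℝ 2 u (Icc 0 1)) :
    ContDiffOn ℝ 1 (D1 u) (Icc 0 1) :=
  hu.derivWithin (uniqueDiffOn_Icc zero_lt_one) (by norm_num)

theorem continuousOn_D1 {u : ℝ → E} (hu : ContDiffOn ℝ 2 u (Icc 0 1)) :
    ContinuousOn (D1 u) (Icc 0 1) := (contDiffOn_D1 hu).continuousOn

theorem continuousOn_D2 {u : ℝ → E} (hu : ContDiffOn ℝ 2 u (Icc 0 1)) :
    ContinuousOn (D2 u) (Icc 0 1) :=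
  (contDiffOn_D1 hu).continuousOn_derivWithin (uniqueDiffOn_Icc zero_lt_one) le_rfl

theorem continuousOn_DQ {u : ℝ → E} (hu : ContDiffOn ℝ 2 u (Icc 0 1)) (h0 : D1 u 0 = 0) :
    ContinuousOn (DQ u) (Icc 0 1) := by
  intro r hr
  rcases eq_or_ne r 0 with rfl | hr0
  · have hd : HasDerivWithinAt (D1 u) (D2 u 0) (Icc 0 1) 0 :=
      (((contDiffOn_D1 hu).differentiableOn one_ne_zero) 0 hr).hasDerivWithinAt
    rw [hasDerivWithinAt_iff_tendsto_slope] at hd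
    have hv : DQ u 0 = D2 u 0 := by simp [DQ]
    rw [← continuousWithinAt_sdiff_self, ContinuousWithinAt, hv]
    refine hd.congr' ?_
    filter_upwards [self_mem_nhdsWithin] with x hx
    have hx0 : x ≠ 0 := hx.2
    simp [DQ, slope, hx0, h0]
  · have h1 : ContinuousWithinAt (fun x => x⁻¹ • D1 u x) (Icc 0 1) r :=
      (continuousWithinAt_id.inv₀ hr0).smul (continuousOn_D1 hu r hr)
    refine h1.congr_of_eventuallyEq ?_ (by simp [DQ, hr0])
    filter_upwards [mem_nhdsWithin_of_mem_nhds (isOpen_ne.mem_nhds hr0)] with x hx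
    have hx' : x ≠ 0 := hx
    simp [DQ, hx']

end Deriv

/-! ### The coefficients of the linearized operator -/

/-- `j(r,u,w)` -/
def jFun (r u w : ℝ) : ℝ := (4 * (u + r * w) ^ 2 + 4 * u ^ 2) / (1 + r ^ 2 * u ^ 2) ^ 2

/-- `a(r,u,w)` -/
def aFun (p r u w : ℝ) : ℝ :=
  jFun r u w ^ ((p - 4) / 2) *
    ((4 * (p - 1) * (u + r * w) ^ 2 + 4 * u ^ 2) / (1 + r ^ 2 * u ^ 2) ^ 2)

/-- `b(r,u,w)` -/
def bFun (p r u w : ℝ) : ℝ :=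
  jFun r u w ^ ((p - 4) / 2) * (12 * p * u ^ 2 / (1 + r ^ 2 * u ^ 2) ^ 3)

/-- `f(r,u,w)`: the remaining terms, such that the equation
`u_t = a(r,u,u_r) u_rr + b(r,u,u_r) u_r / r + f(r,u,u_r)` is the rotationally symmetric
`p`-harmonic flow written for `h = 2 arctan (r u)`. -/
def fFun (p r u w : ℝ) : ℝ :=
  jFun r u w ^ ((p - 4) / 2) * (4 / (1 + r ^ 2 * u ^ 2) ^ 3 *
    (2 * r ^ 4 * (1 - p) * u * w ^ 4
      - r * w ^ 3 * (r ^ 2 * (6 * p - 7) * u ^ 2 - 2 * p + 1)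
      - u * w ^ 2 * (3 * r ^ 2 * (3 * p - 4) * u ^ 2 - 5 * p + 4)
      - r * (9 * p - 16) * u ^ 4 * w
      + 4 * (2 - p) * u ^ 5))

/-- The bracket of the flow `h_t = (h_r² + sin² h / r²)^((p-4)/2) A`, as a function of
`r`, `sin h`, `cos h`, `h_r`, `h_rr`. -/
def flowBracket (p r S C hr hrr : ℝ) : ℝ :=
  (p - 1) * hr ^ 2 * hrr + (p - 3) * (hr ^ 2 * S * C / r ^ 2 - hr * S ^ 2 / r ^ 3)
    + hr ^ 3 / r + hrr * S ^ 2 / r ^ 2 - S ^ 3 * C / r ^ 4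

/-- Consistency of `a`, `b`, `f` with the flow: with `h = 2 arctan (r u)`, `w = u_r`, `z = u_rr`,
one has `h_r² + sin² h / r² = j(r,u,w)` and `h_t = 2 r u_t / (1 + r² u²)`; solving for `u_t` gives
`a z + b w / r + f`. -/
theorem flow_in_terms_of_u (p r u w z : ℝ) (hr : 0 < r) :
    let X := 1 + r ^ 2 * u ^ 2
    let S := 2 * (r * u) / X
    let C := (1 - r ^ 2 * u ^ 2) / X
    let h1 := 2 * (u + r * w) / X
    let h2 := 2 * (2 * w + r * z) / X - 4 * (r * u) * (u + r * w) ^ 2 / X ^ 2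
    h1 ^ 2 + S ^ 2 / r ^ 2 = jFun r u w ∧
      X / (2 * r) * (jFun r u w ^ ((p - 4) / 2) * flowBracket p r S C h1 h2) =
        aFun p r u w * z + bFun p r u w / r * w + fFun p r u w := by
  have hX : (1 + r ^ 2 * u ^ 2) ≠ 0 := by positivity
  have hr' : r ≠ 0 := hr.ne'
  refine ⟨?_, ?_⟩
  · simp only [jFun]
    field_simp
    ring
  · simp only [aFun, bFun, fFun, flowBracket]
    generalize jFun r u w ^ ((p - 4) / 2) = J
    field_simp
    ring

/-- The points around which one linearizes: `u₀ ∈ C²([0,1])`, `u₀ > 0`, `u₀'(0) = 0`. -/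
structure IsDatum (u₀ : ℝ → ℝ) : Prop where
  contDiffOn : ContDiffOn ℝ 2 u₀ (Icc 0 1)
  pos : ∀ r ∈ Icc (0 : ℝ) 1, 0 < u₀ r
  deriv_zero : D1 u₀ 0 = 0

/-- `∂g/∂u (r, u, w)` -/
def partialU (g : ℝ → ℝ → ℝ → ℝ) (r u w : ℝ) : ℝ := deriv (fun u' => g r u' w) u

/-- `∂g/∂w (r, u, w)` -/
def partialW (g : ℝ → ℝ → ℝ → ℝ) (r u w : ℝ) : ℝ := deriv (fun w' => g r u w') w

/-- `g(r, u₀(r), u₀'(r))` -/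
def along (g : ℝ → ℝ → ℝ → ℝ) (u₀ : ℝ → ℝ) (r : ℝ) : ℝ := g r (u₀ r) (D1 u₀ r)

/-- `g` is of class `C¹` near the points `(r, u, w)` with `u > 0`. -/
def Smooth3 (g : ℝ → ℝ → ℝ → ℝ) : Prop :=
  ∀ x : ℝ × ℝ × ℝ, 0 < x.2.1 → ContDiffAt ℝ 1 (fun y : ℝ × ℝ × ℝ => g y.1 y.2.1 y.2.2) x

theorem jFun_pos (r u w : ℝ) (hu : 0 < u) : 0 < jFun r u w := by
  unfold jFun; positivity

theorem smooth3_rpow_j (p : ℝ) : Smooth3 fun r u w => jFun r u w ^ ((p - 4) / 2) := by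
  intro x hx
  refine ContDiffAt.rpow_const_of_ne ?_ (jFun_pos _ _ _ hx).ne'
  unfold jFun
  refine ContDiffAt.div (by fun_prop) (by fun_prop) (by positivity)

theorem smooth3_a (p : ℝ) : Smooth3 (aFun p) := by
  intro x hx
  refine (smooth3_rpow_j p x hx).mul ?_
  exact ContDiffAt.div (by fun_prop) (by fun_prop) (by positivity)

theorem smooth3_b (p : ℝ) : Smooth3 (bFun p) := by
  intro x hx
  refine (smooth3_rpow_j p x hx).mul ?_
  exact ContDiffAt.div (by fun_prop) (by fun_prop) (by positivity)

theorem smooth3_f (p : ℝ) : Smooth3 (fFun p) := by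
  intro x hx
  refine (smooth3_rpow_j p x hx).mul ?_
  refine ContDiffAt.mul ?_ (by fun_prop)
  exact ContDiffAt.div (by fun_prop) (by fun_prop) (by positivity)

theorem IsDatum.continuousOn_triple {u₀ : ℝ → ℝ} (h : IsDatum u₀) :
    ContinuousOn (fun r => ((r, u₀ r, D1 u₀ r) : ℝ × ℝ × ℝ)) (Icc 0 1) :=
  continuousOn_id.prodMk (h.contDiffOn.continuousOn.prodMk (continuousOn_D1 h.contDiffOn))

theorem continuousOn_along {g : ℝ → ℝ → ℝ → ℝ} (hg : Smooth3 g) {u₀ : ℝ → ℝ} (h : IsDatum u₀) :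
    ContinuousOn (along g u₀) (Icc 0 1) := fun r hr =>
  ContinuousAt.comp_continuousWithinAt (f := fun r => ((r, u₀ r, D1 u₀ r) : ℝ × ℝ × ℝ))
    (hg (r, u₀ r, D1 u₀ r) (h.pos r hr)).continuousAt (h.continuousOn_triple r hr)

theorem continuousOn_along_partialW {g : ℝ → ℝ → ℝ → ℝ} (hg : Smooth3 g) {u₀ : ℝ → ℝ}
    (h : IsDatum u₀) : ContinuousOn (along (partialW g) u₀) (Icc 0 1) := by
  have key : ∀ r ∈ Icc (0 : ℝ) 1, along (partialW g) u₀ r =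
      fderiv ℝ (fun y : ℝ × ℝ × ℝ => g y.1 y.2.1 y.2.2) (r, u₀ r, D1 u₀ r) (0, 0, 1) := by
    intro r hr
    have h1 := ((hg (r, u₀ r, D1 u₀ r) (h.pos r hr)).differentiableAt one_ne_zero).hasFDerivAt
    have h2 : HasDerivAt (fun w : ℝ => ((r, u₀ r, w) : ℝ × ℝ × ℝ)) (0, 0, 1) (D1 u₀ r) :=
      (hasDerivAt_const _ _).prodMk ((hasDerivAt_const _ _).prodMk (hasDerivAt_id _))
    exact (h1.comp_hasDerivAt (D1 u₀ r) h2).deriv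
  refine ContinuousOn.congr ?_ key
  intro r hr
  have h1 := (hg (r, u₀ r, D1 u₀ r) (h.pos r hr)).fderiv_right (m := 0) (by norm_num)
  exact (ContinuousAt.comp_continuousWithinAt
    (f := fun r => ((r, u₀ r, D1 u₀ r) : ℝ × ℝ × ℝ)) h1.continuousAt
    (h.continuousOn_triple r hr)).clm_apply continuousWithinAt_const

theorem continuousOn_along_partialU {g : ℝ → ℝ → ℝ → ℝ} (hg : Smooth3 g) {u₀ : ℝ → ℝ}
    (h : IsDatum u₀) : ContinuousOn (along (partialU g) u₀) (Icc 0 1) := by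
  have key : ∀ r ∈ Icc (0 : ℝ) 1, along (partialU g) u₀ r =
      fderiv ℝ (fun y : ℝ × ℝ × ℝ => g y.1 y.2.1 y.2.2) (r, u₀ r, D1 u₀ r) (0, 1, 0) := by
    intro r hr
    have h1 := ((hg (r, u₀ r, D1 u₀ r) (h.pos r hr)).differentiableAt one_ne_zero).hasFDerivAt
    have h2 : HasDerivAt (fun u : ℝ => ((r, u, D1 u₀ r) : ℝ × ℝ × ℝ)) (0, 1, 0) (u₀ r) :=
      (hasDerivAt_const _ _).prodMk ((hasDerivAt_id _).prodMk (hasDerivAt_const _ _))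
    exact (h1.comp_hasDerivAt (u₀ r) h2).deriv
  refine ContinuousOn.congr ?_ key
  intro r hr
  have h1 := (hg (r, u₀ r, D1 u₀ r) (h.pos r hr)).fderiv_right (m := 0) (by norm_num)
  exact (ContinuousAt.comp_continuousWithinAt
    (f := fun r => ((r, u₀ r, D1 u₀ r) : ℝ × ℝ × ℝ)) h1.continuousAt
    (h.continuousOn_triple r hr)).clm_apply continuousWithinAt_const

/-- The coefficient `a(r) = a(r, u₀(r), u₀'(r))` of `v''`. -/
def coeffA (p : ℝ) {u₀ : ℝ → ℝ} (h : IsDatum u₀) : C(Icc (0 : ℝ) 1, ℝ) :=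
  ⟨(Icc 0 1).domRestrict (along (aFun p) u₀), (continuousOn_along (smooth3_a p) h).domRestrict⟩

/-- The coefficient `b(r) = b(r, u₀(r), u₀'(r))` of `v' / r`. -/
def coeffB (p : ℝ) {u₀ : ℝ → ℝ} (h : IsDatum u₀) : C(Icc (0 : ℝ) 1, ℝ) :=
  ⟨(Icc 0 1).domRestrict (along (bFun p) u₀), (continuousOn_along (smooth3_b p) h).domRestrict⟩

/-- The coefficient `c = a_w u₀'' + b_w (u₀' / r) + f_w` of `v'`. -/
def coeffC (p : ℝ) {u₀ : ℝ → ℝ} (h : IsDatum u₀) : C(Icc (0 : ℝ) 1, ℝ) :=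
  ⟨(Icc 0 1).domRestrict fun r => along (partialW (aFun p)) u₀ r * D2 u₀ r
      + along (partialW (bFun p)) u₀ r * DQ u₀ r + along (partialW (fFun p)) u₀ r,
    ((((continuousOn_along_partialW (smooth3_a p) h).mul (continuousOn_D2 h.contDiffOn)).add
      ((continuousOn_along_partialW (smooth3_b p) h).mul
        (continuousOn_DQ h.contDiffOn h.deriv_zero))).add
      (continuousOn_along_partialW (smooth3_f p) h)).domRestrict⟩

/-- The coefficient `d = a_u u₀'' + b_u (u₀' / r) + f_u` of `v`. -/
def coeffD (p : ℝ) {u₀ : ℝ → ℝ} (h : IsDatum u₀) : C(Icc (0 : ℝ) 1, ℝ) :=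
  ⟨(Icc 0 1).domRestrict fun r => along (partialU (aFun p)) u₀ r * D2 u₀ r
      + along (partialU (bFun p)) u₀ r * DQ u₀ r + along (partialU (fFun p)) u₀ r,
    ((((continuousOn_along_partialU (smooth3_a p) h).mul (continuousOn_D2 h.contDiffOn)).add
      ((continuousOn_along_partialU (smooth3_b p) h).mul
        (continuousOn_DQ h.contDiffOn h.deriv_zero))).add
      (continuousOn_along_partialU (smooth3_f p) h)).domRestrict⟩

/-- `M = (inf a)⁻¹ + (inf b)⁻¹ + ‖a‖ + ‖b‖ + ‖c‖ + ‖d‖`, infima and sup norms over `[0,1]`. -/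
def coeffBound (a b c d : C(Icc (0 : ℝ) 1, ℝ)) : ℝ :=
  (⨅ r, a r)⁻¹ + (⨅ r, b r)⁻¹ + ‖a‖ + ‖b‖ + ‖c‖ + ‖d‖

/-! ### The operator on `C([0,1])` -/

/-- A function on `[0,1]` as a function on `ℝ` (its values outside `[0,1]` play no role). -/
def ext (v : C(Icc (0 : ℝ) 1, ℂ)) : ℝ → ℂ := IccExtend zero_le_one v

theorem ext_add (v w : C(Icc (0 : ℝ) 1, ℂ)) : ext (v + w) = ext v + ext w := rfl

theorem ext_smul (z : ℂ) (v : C(Icc (0 : ℝ) 1, ℂ)) : ext (z • v) = z • ext v := rfl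

theorem D1_add {v w : ℝ → ℂ} (hv : ContDiffOn ℝ 2 v (Icc 0 1)) (hw : ContDiffOn ℝ 2 w (Icc 0 1))
    {r : ℝ} (hr : r ∈ Icc (0 : ℝ) 1) : D1 (v + w) r = D1 v r + D1 w r :=
  derivWithin_add (hv.differentiableOn two_ne_zero r hr) (hw.differentiableOn two_ne_zero r hr)

theorem D1_smul {v : ℝ → ℂ} (hv : ContDiffOn ℝ 2 v (Icc 0 1)) (z : ℂ)
    {r : ℝ} (hr : r ∈ Icc (0 : ℝ) 1) : D1 (z • v) r = z • D1 v r :=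
  derivWithin_const_smul z (hv.differentiableOn two_ne_zero r hr)

theorem D2_add {v w : ℝ → ℂ} (hv : ContDiffOn ℝ 2 v (Icc 0 1)) (hw : ContDiffOn ℝ 2 w (Icc 0 1))
    {r : ℝ} (hr : r ∈ Icc (0 : ℝ) 1) : D2 (v + w) r = D2 v r + D2 w r := by
  have h := derivWithin_add ((contDiffOn_D1 hv).differentiableOn one_ne_zero r hr)
    ((contDiffOn_D1 hw).differentiableOn one_ne_zero r hr)
  rw [D2, D2, D2, ← h]
  exact derivWithin_congr (fun x hx => D1_add hv hw hx) (D1_add hv hw hr)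

theorem D2_smul {v : ℝ → ℂ} (hv : ContDiffOn ℝ 2 v (Icc 0 1)) (z : ℂ)
    {r : ℝ} (hr : r ∈ Icc (0 : ℝ) 1) : D2 (z • v) r = z • D2 v r := by
  have h := derivWithin_const_smul z ((contDiffOn_D1 hv).differentiableOn one_ne_zero r hr)
  rw [D2, D2, ← h]
  exact derivWithin_congr (fun x hx => D1_smul hv z hx) (D1_smul hv z hr)

theorem DQ_add {v w : ℝ → ℂ} (hv : ContDiffOn ℝ 2 v (Icc 0 1)) (hw : ContDiffOn ℝ 2 w (Icc 0 1))
    {r : ℝ} (hr : r ∈ Icc (0 : ℝ) 1) : DQ (v + w) r = DQ v r + DQ w r := by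
  by_cases h0 : r = 0
  · subst h0
    simp only [DQ, if_true, D2_add hv hw hr]
  · simp only [DQ, if_neg h0, D1_add hv hw hr, smul_add]

theorem DQ_smul {v : ℝ → ℂ} (hv : ContDiffOn ℝ 2 v (Icc 0 1)) (z : ℂ)
    {r : ℝ} (hr : r ∈ Icc (0 : ℝ) 1) : DQ (z • v) r = z • DQ v r := by
  by_cases h0 : r = 0
  · subst h0
    simp only [DQ, if_true, D2_smul hv z hr]
  · simp only [DQ, if_neg h0, D1_smul hv z hr]
    rw [smul_comm]

/-- `D(L) = {v ∈ C²([0,1]; ℂ) : v'(0) = v(1) = 0}`, as a subspace of `C([0,1]; ℂ)`. -/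
def domL : Submodule ℂ C(Icc (0 : ℝ) 1, ℂ) where
  carrier := {v | ContDiffOn ℝ 2 (ext v) (Icc 0 1) ∧ D1 (ext v) 0 = 0 ∧ v 1 = 0}
  add_mem' := by
    rintro v w ⟨hv, hv0, hv1⟩ ⟨hw, hw0, hw1⟩
    refine ⟨hv.add hw, ?_, by simp [hv1, hw1]⟩
    rw [ext_add, D1_add hv hw (by simp), hv0, hw0, add_zero]
  zero_mem' := by
    have h : ext 0 = fun _ => 0 := rfl
    refine ⟨?_, ?_, rfl⟩
    · rw [h]; exact contDiffOn_const
    · rw [h, D1]; simp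
  smul_mem' := by
    rintro z v ⟨hv, hv0, hv1⟩
    refine ⟨hv.const_smul z, ?_, by simp [hv1]⟩
    rw [ext_smul, D1_smul hv z (by simp), hv0, smul_zero]

/-- `v'` as an element of `C([0,1])`, for `v ∈ D(L)`. -/
def der1 (v : domL) : C(Icc (0 : ℝ) 1, ℂ) :=
  ⟨(Icc 0 1).domRestrict (D1 (ext v)), (continuousOn_D1 v.2.1).domRestrict⟩

/-- `v''` as an element of `C([0,1])`, for `v ∈ D(L)`. -/
def der2 (v : domL) : C(Icc (0 : ℝ) 1, ℂ) :=
  ⟨(Icc 0 1).domRestrict (D2 (ext v)), (continuousOn_D2 v.2.1).domRestrict⟩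

/-- `v' / r` (extended continuously to `r = 0`) as an element of `C([0,1])`, for `v ∈ D(L)`. -/
def derQ (v : domL) : C(Icc (0 : ℝ) 1, ℂ) :=
  ⟨(Icc 0 1).domRestrict (DQ (ext v)), (continuousOn_DQ v.2.1 v.2.2.1).domRestrict⟩

/-- A real continuous function as a complex one. -/
def toC (a : C(Icc (0 : ℝ) 1, ℝ)) : C(Icc (0 : ℝ) 1, ℂ) :=
  ⟨fun r => (a r : ℂ), Complex.continuous_ofReal.comp a.continuous⟩

/-- The operator `v ↦ a v'' + (b / r) v' + c v' + d v` in `C([0,1]; ℂ)` with domain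
`{v ∈ C²([0,1]; ℂ) : v'(0) = v(1) = 0}`. -/
def radialOperator (a b c d : C(Icc (0 : ℝ) 1, ℝ)) :
    C(Icc (0 : ℝ) 1, ℂ) →ₗ.[ℂ] C(Icc (0 : ℝ) 1, ℂ) where
  domain := domL
  toFun :=
    { toFun := fun v => toC a * der2 v + toC b * derQ v + toC c * der1 v + toC d * (v : C(_, ℂ))
      map_add' := by
        intro v w
        ext r
        have h1 : der1 (v + w) r = der1 v r + der1 w r := D1_add v.2.1 w.2.1 r.2
        have h2 : der2 (v + w) r = der2 v r + der2 w r := D2_add v.2.1 w.2.1 r.2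
        have h3 : derQ (v + w) r = derQ v r + derQ w r := DQ_add v.2.1 w.2.1 r.2
        simp only [ContinuousMap.add_apply, ContinuousMap.mul_apply, h1, h2, h3,
          Submodule.coe_add]
        ring
      map_smul' := by
        intro z v
        ext r
        have h1 : der1 (z • v) r = z • der1 v r := D1_smul v.2.1 z r.2
        have h2 : der2 (z • v) r = z • der2 v r := D2_smul v.2.1 z r.2
        have h3 : derQ (z • v) r = z • derQ v r := DQ_smul v.2.1 z r.2
        simp only [ContinuousMap.add_apply, ContinuousMap.mul_apply, ContinuousMap.smul_apply,
          h1, h2, h3, Submodule.coe_smul, RingHom.id_apply, smul_eq_mul]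
        ring }

/-- The linearized operator
`L v = a(r,u₀,u₀') v'' + (b(r,u₀,u₀') / r) v' + c(r) v' + d(r) v`. -/
def linearizedOperator (p : ℝ) {u₀ : ℝ → ℝ} (h : IsDatum u₀) :
    C(Icc (0 : ℝ) 1, ℂ) →ₗ.[ℂ] C(Icc (0 : ℝ) 1, ℂ) :=
  radialOperator (coeffA p h) (coeffB p h) (coeffC p h) (coeffD p h)

/-- The quantity `M` for the coefficients of the linearized operator. -/
def linearizedBound (p : ℝ) {u₀ : ℝ → ℝ} (h : IsDatum u₀) : ℝ :=
  coeffBound (coeffA p h) (coeffB p h) (coeffC p h) (coeffD p h)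

end PHarmonicFlow

end

noncomputable section

namespace PHarmonicFlow

open Set MeasureTheory Filter Topology intervalIntegral ComplexConjugate

/-! Only the continuity of the four coefficients and the positivity of $a$ and $b$ matter. Put
$\beta=b/a$ and let $\rho$ be the integrating factor `wt`, $\rho'=(\beta/r)\rho$, which vanishes at
$0$. Then $av''+(b/r)v'=h$ with $v'(0)=0$ says $v'=\rho^{-1}\int_0^r\rho\,h/a$ (`Adm.eq_prim`). This
formula handles the singularity at $r=0$ and never differentiates $a$.

The sup-norm estimate comes from a localized $L^2$ estimate. Multiply the equation, divided by $a$,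
by $\rho\varphi\bar v$ and integrate by parts; the boundary terms vanish because $\rho(0)=0$ and
$v(1)=0$. Real part plus or minus imaginary part recovers $|z|$ when $\mathrm{Re}\,z\ge0$, and
$|\varphi'|\le\kappa\varphi$ with $\kappa\sim|z|^{1/2}$ lets the cross term be absorbed
(`Adm.energy_le`). Take $\varphi=1/\cosh(\kappa(r-x_0))$ with $x_0$ a maximum point of $|v|$. By
interpolation between $v$ and $v''$ (`norm_deriv_le_interpolation`), $|v|$ stays above half its
maximum on a piece of length $\sim|z|^{-1/2}$ near $x_0$. Polynomial growth of $\rho$ against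
exponential decay of $\varphi$ shows that this piece carries a fixed fraction of the mass of
$\rho\varphi$ (`Adm.integral_wt_bump_le`). Hence $|z|\,\|v\|\le C\|f\|$ (`Adm.sup_estimate`). The
bounds for $v'$ and $v''$ follow, and for large $|z|$ the terms with $c$ and $d$ are a perturbation
(`Bounds.radial_estimate`).

Existence is a shooting argument: the initial value problem at $0$ is a Volterra equation, always
solvable, and the value $v(0)$ can be adjusted to give $v(1)=0$ unless $z-L$ has a kernel
(`Bounds.exists_solution`). So an a priori bound at any $z$ already yields the resolvent there, and
the half-plane estimate extends to a sector by moving horizontally (`isSectorial_of_estimate`). -/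

variable {β : ℝ → ℝ}

/-! ### The integrating factor and its growth -/

/-- The integrating factor of `w' + (β / r) w`, vanishing at `r ≤ 0`. -/
def wt (β : ℝ → ℝ) (r : ℝ) : ℝ := if r ≤ 0 then 0 else Real.exp (∫ s in (1 : ℝ)..r, β s / s)

theorem wt_of_pos {r : ℝ} (hr : 0 < r) : wt β r = Real.exp (∫ s in (1 : ℝ)..r, β s / s) := by
  simp [wt, hr]

theorem wt_pos {r : ℝ} (hr : 0 < r) : 0 < wt β r := by
  rw [wt_of_pos hr]; exact Real.exp_pos _

theorem wt_nonpos {r : ℝ} (hr : r ≤ 0) : wt β r = 0 := by simp [wt, hr]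

theorem wt_nonneg (r : ℝ) : 0 ≤ wt β r := by
  rcases le_or_gt r 0 with h | h
  · rw [wt_nonpos h]
  · exact (wt_pos h).le

theorem intervalIntegrable_div (hβ : Continuous β) {s r : ℝ} (hs : 0 < s) (hr : 0 < r) :
    IntervalIntegrable (fun t => β t / t) volume s r := by
  refine ContinuousOn.intervalIntegrable ?_
  refine hβ.continuousOn.div continuousOn_id fun t ht => ?_
  have : 0 < min s r := lt_min hs hr
  exact (this.trans_le ht.1).ne'

theorem hasDerivAt_wt (hβ : Continuous β) {r : ℝ} (hr : 0 < r) :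
    HasDerivAt (wt β) (β r / r * wt β r) r := by
  have h1 : HasDerivAt (fun r => ∫ s in (1 : ℝ)..r, β s / s) (β r / r) r := by
    have hc : ContinuousOn (fun t => β t / t) (Ioi 0) :=
      hβ.continuousOn.div continuousOn_id fun t ht => (ne_of_gt ht)
    exact integral_hasDerivAt_right (intervalIntegrable_div hβ one_pos hr)
      (hc.stronglyMeasurableAtFilter isOpen_Ioi r hr) (hc.continuousAt (Ioi_mem_nhds hr))
  have h2 := h1.exp
  rw [mul_comm, wt_of_pos hr]
  refine h2.congr_of_eventuallyEq ?_
  filter_upwards [Ioi_mem_nhds hr] with t ht using wt_of_pos ht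

theorem wt_eq_mul (hβ : Continuous β) {s r : ℝ} (hs : 0 < s) (hr : 0 < r) :
    wt β r = Real.exp (∫ t in s..r, β t / t) * wt β s := by
  rw [wt_of_pos hr, wt_of_pos hs, ← Real.exp_add, add_comm,
    integral_add_adjacent_intervals (intervalIntegrable_div hβ one_pos hs)
      (intervalIntegrable_div hβ hs hr)]

/-- Compare $\beta/t$ with $B/t$ in the exponent. This doubling-type bound is what later controls
the weight against exponential decay. -/
theorem wt_le_rpow_mul (hβ : Continuous β) {B : ℝ} (hB : ∀ r, β r ≤ B) {s r : ℝ} (hs : 0 < s)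
    (hsr : s ≤ r) : wt β r ≤ (r / s) ^ B * wt β s := by
  have hr : 0 < r := hs.trans_le hsr
  rw [wt_eq_mul hβ hs hr, Real.rpow_def_of_pos (div_pos hr hs)]
  refine mul_le_mul_of_nonneg_right (Real.exp_le_exp.2 ?_) (wt_nonneg _)
  rw [← integral_one_div_of_pos hs hr, ← intervalIntegral.integral_mul_const]
  refine integral_mono_on hsr (intervalIntegrable_div hβ hs hr) ?_ fun t ht => ?_
  · exact (intervalIntegrable_div (β := fun _ => 1) continuous_const hs hr).mul_const B
  · have : 0 < t := hs.trans_le ht.1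
    rw [one_div_mul_eq_div]
    exact div_le_div_of_nonneg_right (hB t) this.le

theorem rpow_mul_wt_le (hβ : Continuous β) {B : ℝ} (hB : ∀ r, B ≤ β r) {s r : ℝ} (hs : 0 < s)
    (hsr : s ≤ r) : (r / s) ^ B * wt β s ≤ wt β r := by
  have hr : 0 < r := hs.trans_le hsr
  rw [wt_eq_mul hβ hs hr, Real.rpow_def_of_pos (div_pos hr hs)]
  refine mul_le_mul_of_nonneg_right (Real.exp_le_exp.2 ?_) (wt_nonneg _)
  rw [← integral_one_div_of_pos hs hr, ← intervalIntegral.integral_mul_const]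
  refine integral_mono_on hsr ?_ (intervalIntegrable_div hβ hs hr) fun t ht => ?_
  · exact (intervalIntegrable_div (β := fun _ => 1) continuous_const hs hr).mul_const B
  · have : 0 < t := hs.trans_le ht.1
    rw [one_div_mul_eq_div]
    exact div_le_div_of_nonneg_right (hB t) this.le

theorem wt_mono (hβ : Continuous β) (h0 : ∀ r, 0 ≤ β r) : Monotone (wt β) := by
  intro s r hsr
  rcases le_or_gt s 0 with h | h
  · rw [wt_nonpos h]; exact wt_nonneg _
  · simpa using rpow_mul_wt_le hβ h0 h hsr

/-- Only $r=0$ needs an argument. Comparison with $r=1$, where the weight is $1$, bounds it by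
$r^B$, and this tends to $0$ because $B>0$. -/
theorem continuous_wt (hβ : Continuous β) {B : ℝ} (hB0 : 0 < B) (hB : ∀ r, B ≤ β r) :
    Continuous (wt β) := by
  rw [continuous_iff_continuousAt]
  intro r
  rcases lt_trichotomy r 0 with h | rfl | h
  · have : wt β =ᶠ[𝓝 r] fun _ => 0 := by
      filter_upwards [Iio_mem_nhds h] with t ht using wt_nonpos (le_of_lt ht)
    exact continuousAt_const.congr this.symm
  · rw [ContinuousAt, wt_nonpos le_rfl]
    have hlim : Tendsto (fun t : ℝ => |t| ^ B) (𝓝 0) (𝓝 0) := by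
      have : ContinuousAt (fun t : ℝ => |t| ^ B) 0 :=
        (Real.continuousAt_rpow_const _ _ (Or.inr hB0.le)).comp continuous_abs.continuousAt
      simpa [ContinuousAt, Real.zero_rpow hB0.ne'] using this
    refine squeeze_zero' (Eventually.of_forall fun t => wt_nonneg t) ?_ hlim
    filter_upwards [Iio_mem_nhds (zero_lt_one (α := ℝ))] with t ht
    rcases le_or_gt t 0 with h | h
    · rw [wt_nonpos h]; positivity
    · have h1 := rpow_mul_wt_le hβ hB h (le_of_lt ht)
      have h2 : wt β 1 = 1 := by simp [wt]
      rw [h2, one_div, Real.inv_rpow h.le, inv_mul_le_iff₀ (by positivity), mul_one] at h1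
      rwa [abs_of_pos h]
  · exact (hasDerivAt_wt hβ h).continuousAt

/-! ### The singular first-order equation for $v'$ -/

/-- The solution of `w' + (β / r) w = g`, `w(0) = 0`. -/
def prim (β : ℝ → ℝ) (g : ℝ → ℂ) (r : ℝ) : ℂ :=
  ((wt β r)⁻¹ : ℝ) • ∫ s in (0 : ℝ)..r, wt β s • g s

/-- The derivative of `prim β g`. -/
def primDeriv (β : ℝ → ℝ) (g : ℝ → ℂ) (r : ℝ) : ℂ :=
  if r = 0 then (1 + β 0)⁻¹ • g 0 else g r - (β r / r) • prim β g r

/-- The hypotheses on the quotient `β` of the coefficients. -/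
structure Adm (β : ℝ → ℝ) (B₀ B : ℝ) : Prop where
  cont : Continuous β
  pos : 0 < B₀
  lower : ∀ r, B₀ ≤ β r
  upper : ∀ r, β r ≤ B

namespace Adm

variable {B₀ B : ℝ} {g : ℝ → ℂ}

theorem nonneg (h : Adm β B₀ B) (r : ℝ) : 0 ≤ β r := h.pos.le.trans (h.lower r)

theorem B_pos (h : Adm β B₀ B) : 0 < B := h.pos.trans_le ((h.lower 0).trans (h.upper 0))

theorem continuous_wt (h : Adm β B₀ B) : Continuous (wt β) :=
  PHarmonicFlow.continuous_wt h.cont h.pos h.lower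

theorem mono (h : Adm β B₀ B) : Monotone (wt β) := wt_mono h.cont h.nonneg

/-- The weight is monotone, so its quotient at $s\le r$ is at most $1$. -/
theorem norm_prim_le_integral (h : Adm β B₀ B) (hg : Continuous g) {r : ℝ} (hr : 0 ≤ r) :
    ‖prim β g r‖ ≤ ∫ s in (0 : ℝ)..r, ‖g s‖ := by
  rcases hr.eq_or_lt with rfl | hr0
  · simp [prim]
  have hw := wt_pos (β := β) hr0
  rw [prim, norm_smul, Real.norm_of_nonneg (inv_nonneg.2 hw.le), inv_mul_le_iff₀ hw,
    ← intervalIntegral.integral_const_mul]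
  refine (intervalIntegral.norm_integral_le_integral_norm hr).trans ?_
  refine integral_mono_on hr ((h.continuous_wt.smul hg).norm.intervalIntegrable _ _)
    ((hg.norm.const_smul (wt β r)).intervalIntegrable _ _) fun s hs => ?_
  rw [norm_smul, Real.norm_of_nonneg (wt_nonneg s)]
  exact mul_le_mul_of_nonneg_right (h.mono hs.2) (norm_nonneg _)

theorem norm_prim_le (h : Adm β B₀ B) (hg : Continuous g) {G r : ℝ} (hr : 0 ≤ r)
    (hG : ∀ s ∈ Icc 0 r, ‖g s‖ ≤ G) : ‖prim β g r‖ ≤ r * G := by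
  refine (h.norm_prim_le_integral hg hr).trans ?_
  have := integral_mono_on hr (hg.norm.intervalIntegrable 0 r)
    (continuous_const.intervalIntegrable (μ := volume) 0 r) hG
  simpa using this

theorem hasDerivAt_integral (h : Adm β B₀ B) (hg : Continuous g) (r : ℝ) :
    HasDerivAt (fun r => ∫ s in (0 : ℝ)..r, wt β s • g s) (wt β r • g r) r :=
  integral_hasDerivAt_right ((h.continuous_wt.smul hg).intervalIntegrable _ _)
    ((h.continuous_wt.smul hg).stronglyMeasurableAtFilter _ _)
    (h.continuous_wt.smul hg).continuousAt

theorem hasDerivAt_prim (h : Adm β B₀ B) (hg : Continuous g) {r : ℝ} (hr : 0 < r) :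
    HasDerivAt (prim β g) (g r - (β r / r) • prim β g r) r := by
  have hw := (wt_pos (β := β) hr).ne'
  have h1 := ((hasDerivAt_wt h.cont hr).inv hw).smul (h.hasDerivAt_integral hg r)
  refine h1.congr_deriv ?_
  simp only [prim, smul_smul, Pi.inv_apply]
  rw [inv_mul_cancel₀ hw, one_smul, sub_eq_add_neg, ← neg_smul]
  congr 2
  field_simp

/-- Integrate $(\rho w)'=\rho g$ from $0$. Continuity of $w$ at $0$ suffices, since $\rho(0)=0$
removes the boundary term. -/
theorem eq_prim (h : Adm β B₀ B) (hg : Continuous g) {w : ℝ → ℂ}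
    (hw : ContinuousOn w (Icc 0 1))
    (hd : ∀ r ∈ Ioo (0 : ℝ) 1, HasDerivAt w (g r - (β r / r) • w r) r) {r : ℝ}
    (hr : r ∈ Ioc (0 : ℝ) 1) : w r = prim β g r := by
  have h1 : ∫ s in (0 : ℝ)..r, wt β s • g s = wt β r • w r - wt β 0 • w 0 := by
    refine integral_eq_sub_of_hasDerivAt_of_le hr.1.le
      (f := fun s => wt β s • w s)
      (h.continuous_wt.continuousOn.smul (hw.mono (Icc_subset_Icc_right hr.2))) ?_
      ((h.continuous_wt.smul hg).intervalIntegrable _ _)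
    intro x hx
    have hd1 := hd x ⟨hx.1, hx.2.trans_le hr.2⟩
    refine ((hasDerivAt_wt h.cont hx.1).smul hd1).congr_deriv ?_
    simp only [smul_sub, smul_smul]
    rw [mul_comm (β x / x)]
    abel
  have hwr := (wt_pos (β := β) hr.1).ne'
  rw [prim, h1, wt_nonpos le_rfl, zero_smul, sub_zero, smul_smul, inv_mul_cancel₀ hwr, one_smul]

/-- The integrand is the derivative of $s\rho(s)$. Consequently the source $(1+\beta)q$ has the
exact solution $rq$. -/
theorem integral_wt (h : Adm β B₀ B) {r : ℝ} (hr : 0 ≤ r) :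
    ∫ s in (0 : ℝ)..r, wt β s * (1 + β s) = r * wt β r := by
  have h1 : ∫ s in (0 : ℝ)..r, wt β s * (1 + β s) = r * wt β r - 0 * wt β 0 := by
    refine integral_eq_sub_of_hasDerivAt_of_le hr (f := fun s => s * wt β s)
      (continuous_id.mul h.continuous_wt).continuousOn ?_
      ((h.continuous_wt.mul (continuous_const.add h.cont)).intervalIntegrable _ _)
    intro x hx
    refine ((hasDerivAt_id x).mul (hasDerivAt_wt h.cont hx.1)).congr_deriv ?_
    have : x ≠ 0 := hx.1.ne'
    simp only [id]
    field_simp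
  simpa using h1

theorem prim_zero : prim β g 0 = 0 := by simp [prim]

/-- By linearity, subtracting the exact solution $rq$ subtracts its source $(1+\beta)q$. With
$q=g(0)/(1+\beta(0))$ this gives the derivative at the singular endpoint. -/
theorem norm_prim_sub_le (h : Adm β B₀ B) (hg : Continuous g) (q : ℂ) {r ε : ℝ} (hr : 0 ≤ r)
    (hε : ∀ s ∈ Icc 0 r, ‖g s - (1 + β s) • q‖ ≤ ε) : ‖prim β g r - r • q‖ ≤ r * ε := by
  rcases hr.eq_or_lt with rfl | hr0
  · simp [prim]
  have hc : Continuous fun s => g s - (1 + β s) • q :=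
    hg.sub ((continuous_const.add h.cont).smul continuous_const)
  have key : prim β g r - r • q = prim β (fun s => g s - (1 + β s) • q) r := by
    have hw := (wt_pos (β := β) hr0).ne'
    simp only [prim, smul_sub]
    have i1 : Continuous fun s => wt β s • g s := h.continuous_wt.smul hg
    have i2 : Continuous fun s => wt β s • (1 + β s) • q :=
      h.continuous_wt.smul ((continuous_const.add h.cont).smul continuous_const)
    rw [intervalIntegral.integral_sub (i1.intervalIntegrable _ _) (i2.intervalIntegrable _ _)]
    simp only [smul_smul]
    rw [intervalIntegral.integral_smul_const, h.integral_wt hr, smul_sub]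
    congr 1
    rw [smul_smul]
    congr 1
    field_simp
  rw [key]
  exact h.norm_prim_le hc hr hε

theorem tendsto_prim_div (h : Adm β B₀ B) (hg : Continuous g) :
    Tendsto (fun r : ℝ => r⁻¹ • prim β g r) (𝓝[>] 0) (𝓝 ((1 + β 0)⁻¹ • g 0)) := by
  set q := (1 + β 0)⁻¹ • g 0 with hq
  have h1 : 1 + β 0 ≠ 0 := by have := h.nonneg 0; positivity
  have hc : Continuous fun s => g s - (1 + β s) • q :=
    hg.sub ((continuous_const.add h.cont).smul continuous_const)
  have h0 : g 0 - (1 + β 0) • q = 0 := by rw [hq, smul_smul, mul_inv_cancel₀ h1, one_smul, sub_self]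
  rw [Metric.tendsto_nhds]
  intro ε hε
  have h2 := Metric.tendsto_nhds.1 (hc.tendsto 0) (ε / 2) (half_pos hε)
  obtain ⟨δ, hδ, hδ'⟩ := Metric.eventually_nhds_iff.1 h2
  filter_upwards [Ioo_mem_nhdsGT hδ] with r hr
  have h3 := h.norm_prim_sub_le hg q (ε := ε / 2) hr.1.le fun s hs => by
    have := hδ' (y := s) (by
      rw [Real.dist_eq, sub_zero, abs_of_nonneg hs.1]; exact hs.2.trans_lt hr.2)
    rw [h0, dist_zero_right] at this
    exact this.le
  rw [dist_eq_norm]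
  have h4 : r⁻¹ • prim β g r - q = r⁻¹ • (prim β g r - r • q) := by
    rw [smul_sub, smul_smul, inv_mul_cancel₀ hr.1.ne', one_smul]
  rw [h4, norm_smul, Real.norm_of_nonneg (inv_nonneg.2 hr.1.le), inv_mul_lt_iff₀ hr.1]
  nlinarith [mul_pos hr.1 hε]

theorem hasDerivWithinAt_prim (h : Adm β B₀ B) (hg : Continuous g) {r : ℝ} (hr : 0 ≤ r) :
    HasDerivWithinAt (prim β g) (primDeriv β g r) (Ici 0) r := by
  rcases hr.eq_or_lt with rfl | hr0
  · rw [hasDerivWithinAt_iff_tendsto_slope, Ici_sdiff_left, primDeriv, if_pos rfl]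
    refine (h.tendsto_prim_div hg).congr fun x => ?_
    simp [slope, prim_zero]
  · rw [primDeriv, if_neg hr0.ne']
    exact (h.hasDerivAt_prim hg hr0).hasDerivWithinAt

theorem continuousOn_primDeriv (h : Adm β B₀ B) (hg : Continuous g) :
    ContinuousOn (primDeriv β g) (Ici 0) := by
  intro r hr
  rcases (show (0 : ℝ) ≤ r from hr).eq_or_lt with rfl | hr0
  · rw [← continuousWithinAt_sdiff_self, Ici_sdiff_left, ContinuousWithinAt]
    have h1 : Tendsto (fun r => g r - β r • (r⁻¹ • prim β g r)) (𝓝[>] 0)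
        (𝓝 (g 0 - β 0 • ((1 + β 0)⁻¹ • g 0))) :=
      ((hg.tendsto 0).mono_left nhdsWithin_le_nhds).sub
        (((h.cont.tendsto 0).mono_left nhdsWithin_le_nhds).smul (h.tendsto_prim_div hg))
    have h2 : g 0 - β 0 • ((1 + β 0)⁻¹ • g 0) = primDeriv β g 0 := by
      have h1 : 1 + β 0 ≠ 0 := by have := h.nonneg 0; positivity
      have h2 : g 0 = (1 + β 0) • (1 + β 0)⁻¹ • g 0 := by
        rw [smul_smul, mul_inv_cancel₀ h1, one_smul]
      rw [primDeriv, if_pos rfl]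
      nth_rewrite 1 [h2]
      rw [add_smul, one_smul, add_sub_cancel_right]
    rw [← h2]
    refine h1.congr' ?_
    filter_upwards [self_mem_nhdsWithin] with x hx
    rw [primDeriv, if_neg (ne_of_gt hx), smul_smul, div_eq_mul_inv]
  · have h1 : ContinuousAt (fun r => g r - (β r / r) • prim β g r) r :=
      hg.continuousAt.sub ((h.cont.continuousAt.div continuousAt_id hr0.ne').smul
        (h.hasDerivAt_prim hg hr0).continuousAt)
    refine (h1.congr ?_).continuousWithinAt
    filter_upwards [Ioi_mem_nhds hr0] with x hx
    rw [primDeriv, if_neg (ne_of_gt hx)]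

/-! ### The weighted energy estimate -/

/-- The integrand is the derivative of $\rho\varphi v_1\bar v$: the $\beta/r$ term cancels against
$\rho'$, and both boundary values are zero. -/
theorem energy_identity (h : Adm β B₀ B) {φ φ' : ℝ → ℝ} (hφ : ∀ r, HasDerivAt φ (φ' r) r)
    (hφ' : Continuous φ') {v v₁ : ℝ → ℂ} (hg : Continuous g) (hv : Continuous v)
    (hv₁ : Continuous v₁) (hd : ∀ r ∈ Ioo (0 : ℝ) 1, HasDerivAt v (v₁ r) r)
    (hd₁ : ∀ r ∈ Ioo (0 : ℝ) 1, HasDerivAt v₁ (g r - (β r / r) • v₁ r) r) (hv1 : v 1 = 0) :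
    ∫ r in (0 : ℝ)..1, wt β r • (φ r • (g r * conj (v r)) + φ' r • (v₁ r * conj (v r))
      + φ r • (v₁ r * conj (v₁ r))) = 0 := by
  have hφc : Continuous φ := continuous_iff_continuousAt.2 fun r => (hφ r).continuousAt
  have hc : Continuous fun z : ℂ => conj z := Complex.continuous_conj
  have h1 : ∫ r in (0 : ℝ)..1, wt β r • (φ r • (g r * conj (v r)) + φ' r • (v₁ r * conj (v r))
      + φ r • (v₁ r * conj (v₁ r))) =
      wt β 1 • (φ 1 • (v₁ 1 * conj (v 1))) - wt β 0 • (φ 0 • (v₁ 0 * conj (v 0))) := by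
    refine integral_eq_sub_of_hasDerivAt_of_le zero_le_one
      (f := fun r => wt β r • (φ r • (v₁ r * conj (v r))))
      (h.continuous_wt.smul (hφc.smul (hv₁.mul (hc.comp hv)))).continuousOn ?_
      (Continuous.intervalIntegrable (h.continuous_wt.smul
        (((hφc.smul (hg.mul (hc.comp hv))).add (hφ'.smul (hv₁.mul (hc.comp hv)))).add
          (hφc.smul (hv₁.mul (hc.comp hv₁))))) _ _)
    intro r hr
    have e1 := (hd₁ r hr).mul (hd r hr).star
    refine ((hasDerivAt_wt h.cont hr.1).smul ((hφ r).smul e1)).congr_deriv ?_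
    have e2 : star (v r) = conj (v r) := rfl
    have e3 : star (v₁ r) = conj (v₁ r) := rfl
    have e4 : (φ • (v₁ * fun x => star (v x))) r = φ r • (v₁ r * conj (v r)) := rfl
    simp only [e4, Pi.mul_apply, Complex.real_smul, e2, e3, Complex.ofReal_mul,
      Complex.ofReal_div]
    ring
  rw [h1, hv1, wt_nonpos le_rfl]
  simp

/-- The factor $1/a$ is real, so it does not disturb the phase of $z$. The choice of $\kappa$ makes
half of the $|z|$ term pay for the cross term created by $\varphi'$. -/
theorem energy_le (h : Adm β B₀ B) {φ φ' : ℝ → ℝ} (hφ : ∀ r, HasDerivAt φ (φ' r) r)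
    (hφ' : Continuous φ') (hφ0 : ∀ r, 0 ≤ φ r) {κ : ℝ} (hφκ : ∀ r, |φ' r| ≤ κ * φ r)
    {v v₁ f : ℝ → ℂ} (hf : Continuous f) (hv : Continuous v)
    (hv₁ : Continuous v₁) (hd : ∀ r ∈ Ioo (0 : ℝ) 1, HasDerivAt v (v₁ r) r)
    {a : ℝ → ℝ} (ha : Continuous a) {α₀ α₁ : ℝ} (hα₀ : 0 < α₀) (haα₀ : ∀ r, α₀ ≤ a r)
    (haα₁ : ∀ r, a r ≤ α₁) {z : ℂ} (hz : 0 ≤ z.re) (hκ : κ ^ 2 = ‖z‖ / (2 * α₁))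
    (hd₁ : ∀ r ∈ Ioo (0 : ℝ) 1,
      HasDerivAt v₁ ((a r)⁻¹ • (z * v r - f r) - (β r / r) • v₁ r) r) (hv1 : v 1 = 0)
    {F V : ℝ} (hF : ∀ r, ‖f r‖ ≤ F) (hV : ∀ r, ‖v r‖ ≤ V) :
    ‖z‖ / (2 * α₁) * ∫ r in (0 : ℝ)..1, wt β r * φ r * ‖v r‖ ^ 2 ≤
      2 * F * V / α₀ * ∫ r in (0 : ℝ)..1, wt β r * φ r := by
  have hφc : Continuous φ := continuous_iff_continuousAt.2 fun r => (hφ r).continuousAt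
  have hc : Continuous fun z : ℂ => conj z := Complex.continuous_conj
  have ha0 : ∀ r, 0 < a r := fun r => hα₀.trans_le (haα₀ r)
  have hg : Continuous fun r => (a r)⁻¹ • (z * v r - f r) :=
    (ha.inv₀ fun r => (ha0 r).ne').smul ((continuous_const.mul hv).sub hf)
  have hE := h.energy_identity hφ hφ' hg hv hv₁ hd hd₁ hv1
  set H : ℝ → ℂ := fun r => wt β r • (φ r • ((a r)⁻¹ • (z * v r - f r) * conj (v r))
    + φ' r • (v₁ r * conj (v r)) + φ r • (v₁ r * conj (v₁ r))) with hH
  have hHc : Continuous H := h.continuous_wt.smul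
        (((hφc.smul (hg.mul (hc.comp hv))).add (hφ'.smul (hv₁.mul (hc.comp hv)))).add
          (hφc.smul (hv₁.mul (hc.comp hv₁))))
  -- With $\sigma$ the sign of $\mathrm{Im}\,z$, the functional $\mathrm{Re}+\sigma\,\mathrm{Im}$
  -- takes the value $|\mathrm{Re}\,z|+|\mathrm{Im}\,z|\ge|z|$ at $z$ and is the identity on real
  -- numbers such as $|v_1|^2$.
  obtain ⟨σ, hσ, hσ1⟩ : ∃ σ : ℝ, σ * z.im = |z.im| ∧ |σ| ≤ 1 := by
    rcases le_total 0 z.im with h | h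
    · exact ⟨1, by rw [abs_of_nonneg h, one_mul], by simp⟩
    · exact ⟨-1, by rw [abs_of_nonpos h]; ring, by simp⟩
  set L : ℂ →L[ℝ] ℝ := Complex.reCLM + σ • Complex.imCLM with hL
  have hLapp : ∀ w : ℂ, L w = w.re + σ * w.im := fun w => by simp [hL]
  have hLle : ∀ w : ℂ, |L w| ≤ 2 * ‖w‖ := fun w => by
    rw [hLapp]
    refine (abs_add_le _ _).trans ?_
    rw [abs_mul]
    have := Complex.abs_re_le_norm w
    have := Complex.abs_im_le_norm w
    nlinarith [abs_nonneg w.im, abs_nonneg σ]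
  have hLz : ‖z‖ ≤ L z := by
    rw [hLapp, hσ]
    have := Complex.norm_le_abs_re_add_abs_im z
    rwa [abs_of_nonneg hz] at this
  have hint : ∫ r in (0 : ℝ)..1, L (H r) = 0 := by
    rw [L.intervalIntegral_comp_comm (hHc.intervalIntegrable _ _), hE, map_zero]
  have hLr : ∀ (x : ℝ) (w : ℂ), L (x • w) = x * L w := fun x w => by rw [map_smul, smul_eq_mul]
  have hLreal : ∀ x : ℝ, L (x : ℂ) = x := fun x => by simp [hLapp]
  have hpt : ∀ r, wt β r * φ r * (‖z‖ / (2 * α₁) * ‖v r‖ ^ 2) -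
      wt β r * φ r * (2 * F * V / α₀) ≤ L (H r) := by
    intro r
    have hw := wt_nonneg (β := β) r
    have e1 : z * v r * conj (v r) = (‖v r‖ ^ 2) • z := by
      rw [mul_assoc, Complex.mul_conj, Complex.normSq_eq_norm_sq, Complex.real_smul, mul_comm]
    have e2 : v₁ r * conj (v₁ r) = ((‖v₁ r‖ ^ 2 : ℝ) : ℂ) := by
      rw [Complex.mul_conj, Complex.normSq_eq_norm_sq]
    have e3 : L (H r) = wt β r * (φ r * ((a r)⁻¹ * (‖v r‖ ^ 2 * L z - L (f r * conj (v r))))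
        + φ' r * L (v₁ r * conj (v r)) + φ r * ‖v₁ r‖ ^ 2) := by
      simp only [hH, smul_mul_assoc, sub_mul, e1, e2, hLr, map_add, map_sub, hLreal]
    have hV0 : 0 ≤ V := (norm_nonneg _).trans (hV r)
    have hF0 : 0 ≤ F := (norm_nonneg _).trans (hF r)
    have b1 : L (f r * conj (v r)) ≤ 2 * F * V := by
      refine (le_abs_self _).trans ((hLle _).trans ?_)
      rw [norm_mul, RCLike.norm_conj, mul_assoc]
      exact mul_le_mul_of_nonneg_left
        (mul_le_mul (hF r) (hV r) (norm_nonneg _) hF0) zero_le_two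
    have b2 : -(2 * κ * φ r * (‖v₁ r‖ * ‖v r‖)) ≤ φ' r * L (v₁ r * conj (v r)) := by
      refine neg_le_of_abs_le ?_
      rw [abs_mul]
      have := hLle (v₁ r * conj (v r))
      rw [norm_mul, RCLike.norm_conj] at this
      calc |φ' r| * |L (v₁ r * conj (v r))|
          ≤ (κ * φ r) * (2 * (‖v₁ r‖ * ‖v r‖)) :=
            mul_le_mul (hφκ r) this (abs_nonneg _) ((abs_nonneg _).trans (hφκ r))
        _ = _ := by ring
    have b3 : ‖z‖ / α₁ * ‖v r‖ ^ 2 ≤ (a r)⁻¹ * (‖v r‖ ^ 2 * L z) := by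
      rw [div_mul_eq_mul_div, inv_mul_eq_div, mul_comm (‖v r‖ ^ 2)]
      exact div_le_div₀ (mul_nonneg ((norm_nonneg z).trans hLz) (sq_nonneg _)) (mul_le_mul_of_nonneg_right hLz (by positivity))
        (ha0 r) (haα₁ r)
    have b4 : (a r)⁻¹ * L (f r * conj (v r)) ≤ 2 * F * V / α₀ := by
      rw [inv_mul_eq_div]
      exact div_le_div₀ (by positivity) b1 hα₀ (haα₀ r)
    rw [e3, mul_assoc, mul_assoc, ← mul_sub]
    refine mul_le_mul_of_nonneg_left ?_ hw
    have e4 : ‖z‖ / α₁ = 2 * κ ^ 2 := by rw [hκ]; field_simp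
    rw [e4] at b3
    rw [← hκ]
    -- Young's inequality $2\kappa|v_1||v|\le\kappa^2|v|^2+|v_1|^2$: of the available
    -- $2\kappa^2|v|^2$ one half remains.
    nlinarith [mul_le_mul_of_nonneg_left b3 (hφ0 r), mul_le_mul_of_nonneg_left b4 (hφ0 r),
      mul_nonneg (hφ0 r) (sq_nonneg (κ * ‖v r‖ - ‖v₁ r‖))]
  have hc1 : Continuous fun r => wt β r * φ r * (‖z‖ / (2 * α₁) * ‖v r‖ ^ 2) :=
    (h.continuous_wt.mul hφc).mul (continuous_const.mul (hv.norm.pow 2))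
  have hc2 : Continuous fun r => wt β r * φ r * (2 * F * V / α₀) :=
    (h.continuous_wt.mul hφc).mul continuous_const
  have hmono : (∫ r in (0 : ℝ)..1, wt β r * φ r * (‖z‖ / (2 * α₁) * ‖v r‖ ^ 2) -
      wt β r * φ r * (2 * F * V / α₀)) ≤ ∫ r in (0 : ℝ)..1, L (H r) := integral_mono_on (zero_le_one (α := ℝ))
    ((hc1.sub hc2).intervalIntegrable (μ := volume) 0 1)
    ((L.continuous.comp hHc).intervalIntegrable (μ := volume) 0 1) fun r _ => hpt r
  rw [intervalIntegral.integral_sub (hc1.intervalIntegrable _ _) (hc2.intervalIntegrable _ _),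
    intervalIntegral.integral_mul_const] at hmono
  have hfin : ∫ r in (0 : ℝ)..1, wt β r * φ r * (‖z‖ / (2 * α₁) * ‖v r‖ ^ 2) =
      ‖z‖ / (2 * α₁) * ∫ r in (0 : ℝ)..1, wt β r * φ r * ‖v r‖ ^ 2 := by
    rw [← intervalIntegral.integral_const_mul]
    congr 1
    ext r
    ring
  rw [hfin, hint] at hmono
  linarith

end Adm

/-! ### The localizing weight and its mass -/

/-- The weight that localizes the energy estimate near `x₀`. -/
def bump (κ x₀ r : ℝ) : ℝ := (Real.cosh (κ * (r - x₀)))⁻¹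

/-- The derivative of `bump κ x₀`. -/
def bumpDeriv (κ x₀ r : ℝ) : ℝ :=
  -(Real.sinh (κ * (r - x₀)) * κ) / Real.cosh (κ * (r - x₀)) ^ 2

theorem bump_pos (κ x₀ r : ℝ) : 0 < bump κ x₀ r := inv_pos.2 (Real.cosh_pos _)

theorem continuous_bump (κ x₀ : ℝ) : Continuous (bump κ x₀) :=
  (Real.continuous_cosh.comp (by fun_prop)).inv₀ fun _ => (Real.cosh_pos _).ne'

theorem continuous_bumpDeriv (κ x₀ : ℝ) : Continuous (bumpDeriv κ x₀) :=
  ((Real.continuous_sinh.comp (by fun_prop)).mul continuous_const).neg.div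
    ((Real.continuous_cosh.comp (by fun_prop)).pow 2) fun _ => (pow_pos (Real.cosh_pos _) 2).ne'

theorem hasDerivAt_bump (κ x₀ r : ℝ) : HasDerivAt (bump κ x₀) (bumpDeriv κ x₀ r) r := by
  have h1 : HasDerivAt (fun r => κ * (r - x₀)) κ r := by
    simpa using ((hasDerivAt_id r).sub_const x₀).const_mul κ
  exact h1.cosh.inv (Real.cosh_pos _).ne'

theorem abs_bumpDeriv_le {κ : ℝ} (hκ : 0 ≤ κ) (x₀ r : ℝ) :
    |bumpDeriv κ x₀ r| ≤ κ * bump κ x₀ r := by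
  have hc := Real.cosh_pos (κ * (r - x₀))
  have hs : |Real.sinh (κ * (r - x₀))| ≤ Real.cosh (κ * (r - x₀)) := by
    refine abs_le_of_sq_le_sq ?_ hc.le
    rw [Real.cosh_sq]; linarith
  rw [bumpDeriv, bump, abs_div, abs_neg, abs_mul, abs_of_nonneg hκ,
    abs_of_pos (pow_pos hc 2), div_le_iff₀ (pow_pos hc 2)]
  calc |Real.sinh (κ * (r - x₀))| * κ ≤ Real.cosh (κ * (r - x₀)) * κ :=
        mul_le_mul_of_nonneg_right hs hκ
    _ = _ := by field_simp

theorem bump_le_exp (κ x₀ r : ℝ) : bump κ x₀ r ≤ 2 * Real.exp (-|κ * (r - x₀)|) := by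
  rw [bump, ← Real.cosh_abs, Real.exp_neg, Real.cosh_eq, inv_div, div_eq_mul_inv]
  refine mul_le_mul_of_nonneg_left ?_ zero_le_two
  exact inv_anti₀ (Real.exp_pos _) (by linarith [Real.exp_pos (-|κ * (r - x₀)|)])

theorem exp_half_le (t : ℝ) (ht : 0 ≤ t) : Real.exp (-(t / 2)) ≤ 8 * (1 + t ^ 2)⁻¹ := by
  rw [Real.exp_neg, ← div_eq_mul_inv, inv_le_comm₀ (Real.exp_pos _) (by positivity), inv_div,
    div_le_iff₀ (by norm_num)]
  have := Real.quadratic_le_exp_of_nonneg (x := t / 2) (by positivity)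
  nlinarith

/-- Half of the exponential decay is spent on the polynomial factor, using $1+x\le e^x$ at $x=\delta
s/(2B)$. The other half is left to make the integral converge. -/
theorem rpow_mul_exp_le {B δ s : ℝ} (hB : 0 < B) (hδ : 0 < δ) (hs : 0 ≤ s) :
    (3 + 2 * s) ^ B * Real.exp (-(δ * s)) ≤ (3 + 4 * B / δ) ^ B * Real.exp (-(δ * s / 2)) := by
  have h1 : 3 + 2 * s ≤ (3 + 4 * B / δ) * Real.exp (δ * s / (2 * B)) := by
    have h2 := Real.add_one_le_exp (δ * s / (2 * B))
    calc 3 + 2 * s = 3 + 4 * B / δ * (δ * s / (2 * B)) := by field_simp; ring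
      _ ≤ (3 + 4 * B / δ) * (δ * s / (2 * B) + 1) := by
        have : 0 ≤ δ * s / (2 * B) := by positivity
        have : 0 ≤ 4 * B / δ := by positivity
        nlinarith
      _ ≤ _ := mul_le_mul_of_nonneg_left h2 (by positivity)
  have h3 : (3 + 2 * s) ^ B ≤ (3 + 4 * B / δ) ^ B * Real.exp (δ * s / 2) := by
    refine (Real.rpow_le_rpow (by positivity) h1 hB.le).trans_eq ?_
    rw [Real.mul_rpow (by positivity) (Real.exp_pos _).le, ← Real.exp_mul]
    congr 2
    field_simp
  calc _ ≤ (3 + 4 * B / δ) ^ B * Real.exp (δ * s / 2) * Real.exp (-(δ * s)) :=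
        mul_le_mul_of_nonneg_right h3 (Real.exp_pos _).le
    _ = _ := by rw [mul_assoc, ← Real.exp_add]; congr 2; ring

theorem integral_inv_one_add_mul_sq_le {κ : ℝ} (hκ : 0 < κ) (x₀ a b : ℝ) :
    ∫ r in a..b, (1 + (κ * (r - x₀)) ^ 2)⁻¹ ≤ Real.pi / κ := by
  have h1 := intervalIntegral.integral_comp_mul_sub (fun y : ℝ => (1 + y ^ 2)⁻¹) hκ.ne' (κ * x₀)
    (a := a) (b := b)
  simp only [← mul_sub] at h1
  rw [h1, integral_inv_one_add_sq, smul_eq_mul, inv_mul_eq_div]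
  refine div_le_div_of_nonneg_right ?_ hκ.le
  have := Real.arctan_lt_pi_div_two (κ * (b - x₀))
  have := Real.neg_pi_div_two_lt_arctan (κ * (a - x₀))
  linarith

namespace Adm

variable {B₀ B : ℝ} {g : ℝ → ℂ}

/-- The weighted mass of the localizing weight is comparable to its mass near `x₀`. -/
theorem integral_wt_bump_le (h : Adm β B₀ B) {κ ℓ x₀ : ℝ} (hκ : 0 < κ) (hℓ : 0 < ℓ)
    (hℓ1 : ℓ ≤ 1 / 2) (hx₀ : x₀ ∈ Icc (0 : ℝ) 1) :
    ∃ y, (∀ r ∈ Icc y (y + ℓ / 2), r ∈ Icc (0 : ℝ) 1 ∧ |r - x₀| ≤ ℓ) ∧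
      0 < ∫ r in y..(y + ℓ / 2), wt β r * bump κ x₀ r ∧
      ∫ r in (0 : ℝ)..1, wt β r * bump κ x₀ r ≤
        32 * (3 + 4 * B / (κ * ℓ)) ^ B * Real.pi * Real.cosh (κ * ℓ) / (κ * ℓ) *
          ∫ r in y..(y + ℓ / 2), wt β r * bump κ x₀ r := by
  -- The interval is placed on the side of $x_0$ that stays inside $[0,1]$. Requiring $y\ge\ell/2$
  -- keeps it away from the zero of the weight and gives $r/y\le 3+2|r-x_0|/\ell$ for $r\ge y$.
  obtain ⟨y, hy, hyx, hI⟩ : ∃ y, ℓ / 2 ≤ y ∧ |y - x₀| ≤ ℓ ∧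
      ∀ r ∈ Icc y (y + ℓ / 2), r ∈ Icc (0 : ℝ) 1 ∧ |r - x₀| ≤ ℓ := by
    rcases le_or_gt x₀ (1 / 2) with hx | hx
    · refine ⟨x₀ + ℓ / 2, by linarith [hx₀.1], ?_, fun r hr => ⟨⟨?_, ?_⟩, ?_⟩⟩
      · rw [abs_le]; constructor <;> linarith
      · linarith [hr.1, hx₀.1]
      · linarith [hr.2]
      · rw [abs_le]; constructor <;> linarith [hr.1, hr.2]
    · refine ⟨x₀ - ℓ / 2, by linarith, ?_, fun r hr => ⟨⟨?_, ?_⟩, ?_⟩⟩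
      · rw [abs_le]; constructor <;> linarith
      · linarith [hr.1]
      · linarith [hr.2, hx₀.2]
      · rw [abs_le]; constructor <;> linarith [hr.1, hr.2]
  have hB := h.B_pos
  have hy0 : 0 < y := by linarith
  have hwy := wt_pos (β := β) hy0
  set δ := κ * ℓ with hδ
  have hδ0 : 0 < δ := mul_pos hκ hℓ
  set D := (3 + 4 * B / δ) ^ B with hD
  have hD0 : 0 < D := Real.rpow_pos_of_pos (by positivity) _
  have hc : Continuous fun r => wt β r * bump κ x₀ r :=
    h.continuous_wt.mul (continuous_bump κ x₀)
  have hlow : ℓ / 2 * (wt β y * (Real.cosh δ)⁻¹) ≤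
      ∫ r in y..(y + ℓ / 2), wt β r * bump κ x₀ r := by
    have := integral_mono_on (μ := volume) (show y ≤ y + ℓ / 2 by linarith)
      ((continuous_const (y := wt β y * (Real.cosh δ)⁻¹)).intervalIntegrable _ _)
      (hc.intervalIntegrable _ _) fun r hr => by
        refine mul_le_mul (h.mono hr.1) ?_ (inv_pos.2 (Real.cosh_pos _)).le (wt_nonneg _)
        refine inv_anti₀ (Real.cosh_pos _) ?_
        rw [Real.cosh_le_cosh, abs_mul, abs_of_pos hκ, abs_of_pos hδ0]
        exact mul_le_mul_of_nonneg_left (hI r hr).2 hκ.le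
    rwa [intervalIntegral.integral_const, add_sub_cancel_left, smul_eq_mul] at this
  have hpos : 0 < ℓ / 2 * (wt β y * (Real.cosh δ)⁻¹) := by
    have := Real.cosh_pos δ
    positivity
  refine ⟨y, hI, hpos.trans_le hlow, ?_⟩
  have hpt : ∀ r ∈ Icc (0 : ℝ) 1, wt β r * bump κ x₀ r ≤
      16 * D * wt β y * (1 + (κ * (r - x₀)) ^ 2)⁻¹ := by
    intro r hr
    set s := |r - x₀| / ℓ with hs
    have hs0 : 0 ≤ s := by positivity
    have h1 : wt β r ≤ (3 + 2 * s) ^ B * wt β y := by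
      rcases le_total r y with hry | hyr
      · refine (h.mono hry).trans (le_mul_of_one_le_left hwy.le ?_)
        exact Real.one_le_rpow (by linarith) hB.le
      · refine (wt_le_rpow_mul h.cont h.upper hy0 hyr).trans
          (mul_le_mul_of_nonneg_right ?_ hwy.le)
        refine Real.rpow_le_rpow (by positivity [hy0.trans_le hyr]) ?_ hB.le
        rw [div_le_iff₀ hy0]
        have h2 : r - y ≤ s * ℓ + ℓ := by
          rw [hs, div_mul_cancel₀ _ hℓ.ne']
          linarith [le_abs_self (r - x₀), neg_abs_le (y - x₀)]
        nlinarith [mul_le_mul_of_nonneg_left hy hs0]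
    have h2 : |κ * (r - x₀)| = δ * s := by
      rw [abs_mul, abs_of_pos hκ, hs, hδ]; field_simp
    have h3 := bump_le_exp κ x₀ r
    rw [h2] at h3
    have h4 := rpow_mul_exp_le hB hδ0 hs0
    have h5 := exp_half_le (δ * s) (by positivity)
    rw [← h2, sq_abs, h2] at h5
    calc wt β r * bump κ x₀ r
        ≤ ((3 + 2 * s) ^ B * wt β y) * (2 * Real.exp (-(δ * s))) :=
          mul_le_mul h1 h3 (bump_pos _ _ _).le (by positivity)
      _ = 2 * wt β y * ((3 + 2 * s) ^ B * Real.exp (-(δ * s))) := by ring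
      _ ≤ 2 * wt β y * (D * (8 * (1 + (κ * (r - x₀)) ^ 2)⁻¹)) :=
          mul_le_mul_of_nonneg_left (h4.trans (mul_le_mul_of_nonneg_left h5 hD0.le))
            (by positivity)
      _ = _ := by ring
  have hc2 : Continuous fun r => 16 * D * wt β y * (1 + (κ * (r - x₀)) ^ 2)⁻¹ :=
    continuous_const.mul (Continuous.inv₀ (by fun_prop) fun r => by positivity)
  have hup := integral_mono_on (μ := volume) (zero_le_one (α := ℝ))
    (hc.intervalIntegrable _ _) (hc2.intervalIntegrable _ _) hpt
  rw [intervalIntegral.integral_const_mul] at hup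
  calc _ ≤ _ := hup
    _ ≤ 16 * D * wt β y * (Real.pi / κ) :=
      mul_le_mul_of_nonneg_left (integral_inv_one_add_mul_sq_le hκ _ _ _) (by positivity)
    _ = 32 * D * Real.pi * Real.cosh δ / δ * (ℓ / 2 * (wt β y * (Real.cosh δ)⁻¹)) := by
      have := (Real.cosh_pos δ).ne'
      rw [hδ] at this ⊢
      field_simp
      norm_num
    _ ≤ _ := mul_le_mul_of_nonneg_left hlow (by
      have := Real.cosh_pos δ
      have := Real.pi_pos
      positivity)

/-! ### Pointwise bounds and interpolation -/

theorem norm_primDeriv_le (h : Adm β B₀ B) (hg : Continuous g) {G r : ℝ} (hr : 0 ≤ r)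
    (hG : ∀ s ∈ Icc 0 r, ‖g s‖ ≤ G) : ‖primDeriv β g r‖ ≤ (1 + B) * G := by
  have hG0 : 0 ≤ G := (norm_nonneg _).trans (hG r ⟨hr, le_rfl⟩)
  have hB := h.B_pos
  have hβ := h.nonneg
  rw [primDeriv]
  split_ifs with h0
  · rw [norm_smul, norm_inv, Real.norm_of_nonneg (by linarith [hβ 0])]
    have h1 : (1 + β 0)⁻¹ ≤ 1 := inv_le_one_of_one_le₀ (by linarith [hβ 0])
    have := hG 0 ⟨le_rfl, hr⟩
    nlinarith [norm_nonneg (g 0)]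
  · have hr0 : 0 < r := lt_of_le_of_ne hr (Ne.symm h0)
    refine (norm_sub_le _ _).trans ?_
    rw [norm_smul, Real.norm_of_nonneg (div_nonneg (hβ r) hr)]
    have h1 := h.norm_prim_le hg hr hG
    have h2 : β r / r * ‖prim β g r‖ ≤ B * G := by
      calc β r / r * ‖prim β g r‖ ≤ β r / r * (r * G) :=
            mul_le_mul_of_nonneg_left h1 (div_nonneg (hβ r) hr)
        _ = β r * G := by field_simp
        _ ≤ B * G := mul_le_mul_of_nonneg_right (h.upper r) hG0
    linarith [hG r ⟨hr, le_rfl⟩]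

theorem continuous_prim (h : Adm β B₀ B) (hg : Continuous g) : Continuous (prim β g) := by
  rw [continuous_iff_continuousAt]
  intro r
  rcases lt_trichotomy r 0 with hr | rfl | hr
  · refine continuousAt_const (y := (0 : ℂ)).congr ?_
    filter_upwards [Iio_mem_nhds hr] with t ht
    simp [prim, wt_nonpos (le_of_lt ht)]
  · refine continuousAt_iff_continuous_left_right.2
      ⟨?_, (h.hasDerivWithinAt_prim hg le_rfl).continuousWithinAt⟩
    refine continuousWithinAt_const (b := (0 : ℂ)).congr (fun t ht => ?_) prim_zero
    simp [prim, wt_nonpos ht]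
  · exact (h.hasDerivAt_prim hg hr).continuousAt

end Adm

/-- Interpolation between `w` and `w''` on `[0,1]`. -/
theorem norm_deriv_le_interpolation {w w₁ w₂ : ℝ → ℂ} {V W t : ℝ}
    (hw : ∀ r ∈ Icc (0 : ℝ) 1, HasDerivWithinAt w (w₁ r) (Icc 0 1) r)
    (hw₁ : ∀ r ∈ Icc (0 : ℝ) 1, HasDerivWithinAt w₁ (w₂ r) (Icc 0 1) r)
    (hV : ∀ r ∈ Icc (0 : ℝ) 1, ‖w r‖ ≤ V) (hW : ∀ r ∈ Icc (0 : ℝ) 1, ‖w₂ r‖ ≤ W)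
    (ht : 0 < t) (ht1 : t ≤ 1 / 2) {x : ℝ} (hx : x ∈ Icc (0 : ℝ) 1) :
    ‖w₁ x‖ ≤ 2 * V / t + t * W := by
  obtain ⟨y, hy, hyx⟩ : ∃ y ∈ Icc (0 : ℝ) 1, |y - x| = t := by
    rcases le_or_gt x (1 / 2) with h | h
    · exact ⟨x + t, ⟨by linarith [hx.1], by linarith⟩, by rw [add_sub_cancel_left, abs_of_pos ht]⟩
    · refine ⟨x - t, ⟨by linarith, by linarith [hx.2]⟩, ?_⟩
      rw [sub_sub_cancel_left, abs_neg, abs_of_pos ht]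
  have hW0 : 0 ≤ W := (norm_nonneg _).trans (hW x hx)
  have hsub : uIcc x y ⊆ Icc 0 1 := uIcc_subset_Icc hx hy
  have h1 : ∀ s ∈ uIcc x y, ‖w₁ s - w₁ x‖ ≤ W * t := by
    intro s hs
    have h2 := (convex_Icc (0 : ℝ) 1).norm_image_sub_le_of_norm_hasDerivWithin_le hw₁ hW hx
      (hsub hs)
    refine h2.trans (mul_le_mul_of_nonneg_left ?_ hW0)
    rw [← hyx]
    exact abs_sub_left_of_mem_uIcc hs
  have h3 := (convex_uIcc x y).norm_image_sub_le_of_norm_hasDerivWithin_le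
    (f := fun s => w s - s • w₁ x) (f' := fun s => w₁ s - w₁ x) (C := W * t)
    (fun s hs => ((hw s (hsub hs)).mono hsub).sub
      (by simpa using (hasDerivWithinAt_id s (uIcc x y)).smul_const (w₁ x)))
    h1 left_mem_uIcc right_mem_uIcc
  rw [Real.norm_eq_abs, hyx] at h3
  have h4 : ‖(y - x) • w₁ x‖ ≤ 2 * V + W * t * t := by
    have e : (y - x) • w₁ x = w y - w x - ((w y - y • w₁ x) - (w x - x • w₁ x)) := by
      rw [sub_smul]; abel
    rw [e]
    refine (norm_sub_le _ _).trans ?_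
    have := norm_sub_le (w y) (w x)
    linarith [hV x hx, hV y hy]
  rw [norm_smul, Real.norm_eq_abs, hyx] at h4
  calc ‖w₁ x‖ = t * ‖w₁ x‖ / t := by field_simp
    _ ≤ (2 * V + W * t * t) / t := div_le_div_of_nonneg_right h4 ht.le
    _ = _ := by field_simp

/-! ### The a priori estimate for the principal part -/

/-- The constant in `Adm.sup_estimate`. -/
def supConst (α₀ α₁ B : ℝ) : ℝ :=
  1 + 16 * α₁ / α₀ *
    (32 * (3 + 4 * B / ((4 + 4 * ((1 + B) / α₀))⁻¹ / √(2 * α₁))) ^ B * Real.pi *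
      Real.cosh ((4 + 4 * ((1 + B) / α₀))⁻¹ / √(2 * α₁)) /
      ((4 + 4 * ((1 + B) / α₀))⁻¹ / √(2 * α₁)))

/-- The constant in `Adm.full_estimate`. -/
def fullConst (α₀ α₁ B : ℝ) : ℝ := (4 + 3 * ((1 + B) / α₀)) * (supConst α₀ α₁ B + 1)

theorem one_le_supConst {α₀ α₁ B : ℝ} (h₀ : 0 < α₀) (h₁ : 0 < α₁) (hB : 0 < B) :
    1 ≤ supConst α₀ α₁ B := by
  rw [supConst, le_add_iff_nonneg_right]
  have := Real.pi_pos
  have := Real.cosh_pos ((4 + 4 * ((1 + B) / α₀))⁻¹ / √(2 * α₁))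
  positivity

/-- The data of a solution of `z v - a v'' - (b / r) v' = f`, `v'(0) = v(1) = 0`, with `β = b / a`. -/
structure IsSol (β a : ℝ → ℝ) (z : ℂ) (f v : ℝ → ℂ) : Prop where
  cont : Continuous v
  deriv : ∀ r ∈ Icc (0 : ℝ) 1,
    HasDerivWithinAt v (prim β (fun r => (a r)⁻¹ • (z * v r - f r)) r) (Icc 0 1) r
  one : v 1 = 0

namespace Adm

variable {B₀ B : ℝ} {a : ℝ → ℝ} {α₀ α₁ : ℝ} {z : ℂ} {f v : ℝ → ℂ} {F V : ℝ}

theorem continuous_rhs (ha : Continuous a) (hα₀ : 0 < α₀) (haα₀ : ∀ r, α₀ ≤ a r)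
    (hf : Continuous f) (hv : Continuous v) :
    Continuous fun r => (a r)⁻¹ • (z * v r - f r) :=
  (ha.inv₀ fun r => (hα₀.trans_le (haα₀ r)).ne').smul ((continuous_const.mul hv).sub hf)

theorem norm_rhs_le (hα₀ : 0 < α₀) (haα₀ : ∀ r, α₀ ≤ a r)
    (hF : ∀ r, ‖f r‖ ≤ F) (hV : ∀ r, ‖v r‖ ≤ V) (r : ℝ) :
    ‖(a r)⁻¹ • (z * v r - f r)‖ ≤ (‖z‖ * V + F) / α₀ := by
  have h1 : ‖z * v r - f r‖ ≤ ‖z‖ * V + F := by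
    refine (norm_sub_le _ _).trans (add_le_add ?_ (hF r))
    rw [norm_mul]
    exact mul_le_mul_of_nonneg_left (hV r) (norm_nonneg _)
  rw [norm_smul, norm_inv, Real.norm_of_nonneg (hα₀.trans_le (haα₀ r)).le, inv_mul_eq_div]
  exact div_le_div₀ ((norm_nonneg _).trans h1) h1 hα₀ (haα₀ r)

theorem norm_second_le (h : Adm β B₀ B) (ha : Continuous a) (hα₀ : 0 < α₀)
    (haα₀ : ∀ r, α₀ ≤ a r) (hf : Continuous f) (hv : Continuous v)
    (hF : ∀ r, ‖f r‖ ≤ F) (hV : ∀ r, ‖v r‖ ≤ V) {r : ℝ} (hr : 0 ≤ r) :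
    ‖primDeriv β (fun r => (a r)⁻¹ • (z * v r - f r)) r‖ ≤
      (1 + B) / α₀ * (‖z‖ * V + F) := by
  refine (h.norm_primDeriv_le (continuous_rhs ha hα₀ haα₀ hf hv) hr
    fun s _ => norm_rhs_le hα₀ haα₀ hF hV s).trans_eq ?_
  ring

/-- Interpolation at the natural length $t=|z|^{-1/2}$; the condition $|z|\ge4$ is exactly
$t\le1/2$. -/
theorem norm_first_le (h : Adm β B₀ B) (ha : Continuous a) (hα₀ : 0 < α₀)
    (haα₀ : ∀ r, α₀ ≤ a r) (hf : Continuous f) (hs : IsSol β a z f v) (hz4 : 4 ≤ ‖z‖)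
    (hF : ∀ r, ‖f r‖ ≤ F) (hV : ∀ r, ‖v r‖ ≤ V) {r : ℝ} (hr : r ∈ Icc (0 : ℝ) 1) :
    ‖prim β (fun r => (a r)⁻¹ • (z * v r - f r)) r‖ ≤
      2 * V * √‖z‖ + (1 + B) / α₀ * (‖z‖ * V + F) / √‖z‖ := by
  have hz2 : 2 ≤ √‖z‖ := Real.le_sqrt_of_sq_le (by norm_num; exact hz4)
  have hg := continuous_rhs (z := z) ha hα₀ haα₀ hf hs.cont
  refine (norm_deriv_le_interpolation (t := (√‖z‖)⁻¹) hs.deriv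
    (fun r hr => (h.hasDerivWithinAt_prim hg hr.1).mono Icc_subset_Ici_self)
    (fun r _ => hV r) (fun r hr => h.norm_second_le ha hα₀ haα₀ hf hs.cont hF hV hr.1)
    (by positivity) ?_ hr).trans_eq ?_
  · rw [one_div]; exact inv_anti₀ two_pos hz2
  · field_simp

/-- The energy estimate bounds the local mass of $|v|^2$ near a maximum point $x_0$ from above by a
multiple of $FV/|z|$, while $|v|\ge V/2$ there bounds it from below by a multiple of $V^2$. The
common mass and one factor $V$ cancel. -/
theorem sup_estimate (h : Adm β B₀ B) (ha : Continuous a) (hα₀ : 0 < α₀)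
    (haα₀ : ∀ r, α₀ ≤ a r) (haα₁ : ∀ r, a r ≤ α₁) (hf : Continuous f)
    (hs : IsSol β a z f v) (hz : 0 ≤ z.re) (hz4 : 4 ≤ ‖z‖) (hF : ∀ r, ‖f r‖ ≤ F)
    (hV : ∀ r, ‖v r‖ ≤ V) {x₀ : ℝ} (hx₀ : x₀ ∈ Icc (0 : ℝ) 1) (hVx₀ : ‖v x₀‖ = V) :
    ‖z‖ * V ≤ supConst α₀ α₁ B * F := by
  have hα₁ : 0 < α₁ := hα₀.trans_le ((haα₀ 0).trans (haα₁ 0))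
  have hB := h.B_pos
  have hF0 : 0 ≤ F := (norm_nonneg _).trans (hF 0)
  have hsup := one_le_supConst hα₀ hα₁ hB
  -- The first case is trivial because the constant is at least $1$. In the second, $F$ is absorbed
  -- into $|z|V$, and interpolation gives $|v'|\le(2+2C_2)V|z|^{1/2}$.
  rcases le_or_gt (‖z‖ * V) F with hFV | hFV
  · exact hFV.trans (le_mul_of_one_le_left hF0 hsup)
  have hz0 : 0 < ‖z‖ := by linarith
  have hVpos : 0 < V := pos_of_mul_pos_right (hF0.trans_lt hFV) hz0.le
  set s := √‖z‖ with hs_def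
  have hs2 : 2 ≤ s := Real.le_sqrt_of_sq_le (by norm_num; exact hz4)
  have hss : s * s = ‖z‖ := Real.mul_self_sqrt hz0.le
  have hs0 : 0 < s := by linarith
  set C₂ := (1 + B) / α₀ with hC₂
  have hC₂0 : 0 < C₂ := by positivity
  -- Chosen so that $|v|$ can drop by at most $V/2$ over the distance $\ell=\varepsilon|z|^{-1/2}$.
  set ε := (4 + 4 * C₂)⁻¹ with hε
  have hε0 : 0 < ε := by positivity
  set q := √(2 * α₁) with hq
  have hq0 : 0 < q := Real.sqrt_pos.2 (by positivity)
  have hqq : q * q = 2 * α₁ := Real.mul_self_sqrt (by positivity)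
  have hg := continuous_rhs (z := z) ha hα₀ haα₀ hf hs.cont
  set v₁ := prim β (fun r => (a r)⁻¹ • (z * v r - f r)) with hv₁
  have hv₁c : Continuous v₁ := h.continuous_prim hg
  have hv₁le : ∀ r ∈ Icc (0 : ℝ) 1, ‖v₁ r‖ ≤ (2 + 2 * C₂) * V * s := by
    intro r hr
    refine (h.norm_first_le ha hα₀ haα₀ hf hs hz4 hF hV hr).trans ?_
    have : C₂ * (‖z‖ * V + F) / s ≤ 2 * C₂ * V * s := by
      rw [div_le_iff₀ hs0]
      have h1 : C₂ * (‖z‖ * V + F) ≤ C₂ * (2 * (‖z‖ * V)) :=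
        mul_le_mul_of_nonneg_left (by linarith) hC₂0.le
      rw [← hss] at h1 ⊢
      linarith
    linarith
  set κ := s / q with hκ
  set ℓ := ε / s with hℓ
  have hκ0 : 0 < κ := by positivity
  have hℓ0 : 0 < ℓ := by positivity
  have hε1 : ε ≤ 1 := inv_le_one_of_one_le₀ (by linarith)
  have hℓ1 : ℓ ≤ 1 / 2 := by
    rw [hℓ, div_le_iff₀ hs0]; linarith
  -- The powers of $|z|$ cancel, so the mass comparison constant does not depend on $z$.
  have hκℓ : κ * ℓ = ε / q := by rw [hκ, hℓ]; field_simp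
  obtain ⟨y, hI, hpos, hle⟩ := h.integral_wt_bump_le hκ0 hℓ0 hℓ1 hx₀
  rw [hκℓ] at hle
  set K := 32 * (3 + 4 * B / (ε / q)) ^ B * Real.pi * Real.cosh (ε / q) / (ε / q) with hK
  have hKs : supConst α₀ α₁ B = 1 + 16 * α₁ / α₀ * K := rfl
  have hen := h.energy_le (hasDerivAt_bump κ x₀) (continuous_bumpDeriv κ x₀)
    (fun r => (bump_pos κ x₀ r).le) (abs_bumpDeriv_le hκ0.le x₀) hf hs.cont hv₁c
    (fun r hr => (hs.deriv r (Ioo_subset_Icc_self hr)).hasDerivAt (Icc_mem_nhds hr.1 hr.2))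
    ha hα₀ haα₀ haα₁ hz
    (by rw [hκ, div_pow, sq, sq, hss, hqq]) (fun r hr => h.hasDerivAt_prim hg hr.1) hs.one hF hV
  set J := ∫ r in y..(y + ℓ / 2), wt β r * bump κ x₀ r with hJ
  have hc : Continuous fun r => wt β r * bump κ x₀ r :=
    h.continuous_wt.mul (continuous_bump κ x₀)
  have hcv : Continuous fun r => wt β r * bump κ x₀ r * ‖v r‖ ^ 2 := hc.mul (hs.cont.norm.pow 2)
  have hnn : ∀ r, 0 ≤ wt β r * bump κ x₀ r := fun r =>
    mul_nonneg (wt_nonneg r) (bump_pos _ _ _).le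
  have hyI := hI y ⟨le_rfl, by linarith⟩
  have hyI' := hI (y + ℓ / 2) ⟨by linarith, le_rfl⟩
  have hloc : J * (V / 2) ^ 2 ≤ ∫ r in (0 : ℝ)..1, wt β r * bump κ x₀ r * ‖v r‖ ^ 2 := by
    rw [hJ, ← intervalIntegral.integral_mul_const]
    refine (integral_mono_on (by linarith) ((hc.mul continuous_const).intervalIntegrable _ _)
      (hcv.intervalIntegrable _ _) fun r hr => ?_).trans
      (integral_mono_interval hyI.1.1 (by linarith) hyI'.1.2
        (Eventually.of_forall fun r => mul_nonneg (hnn r) (sq_nonneg _))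
        (hcv.intervalIntegrable _ _))
    refine mul_le_mul_of_nonneg_left ?_ (hnn r)
    refine pow_le_pow_left₀ (by positivity) ?_ 2
    have h1 := (convex_Icc (0 : ℝ) 1).norm_image_sub_le_of_norm_hasDerivWithin_le hs.deriv hv₁le
      hx₀ (hI r hr).1
    have h2 : (2 + 2 * C₂) * V * s * ‖r - x₀‖ ≤ V / 2 := by
      calc (2 + 2 * C₂) * V * s * ‖r - x₀‖ ≤ (2 + 2 * C₂) * V * s * ℓ :=
            mul_le_mul_of_nonneg_left (hI r hr).2 (by positivity)
        _ = V / 2 := by rw [hℓ, hε]; field_simp; ring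
    have h3 := norm_sub_norm_le (v x₀) (v r)
    rw [norm_sub_rev, hVx₀] at h3
    linarith
  have hfin : ‖z‖ / (2 * α₁) * (J * (V / 2) ^ 2) ≤ 2 * F * V / α₀ * (K * J) :=
    (mul_le_mul_of_nonneg_left hloc (by positivity)).trans
      (hen.trans (mul_le_mul_of_nonneg_left hle (by positivity)))
  have hfin2 : J * V * (‖z‖ * V) ≤ J * V * (16 * α₁ / α₀ * K * F) := by
    have e1 : J * V * (‖z‖ * V) = 8 * α₁ * (‖z‖ / (2 * α₁) * (J * (V / 2) ^ 2)) := by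
      field_simp; ring
    have e2 : J * V * (16 * α₁ / α₀ * K * F) = 8 * α₁ * (2 * F * V / α₀ * (K * J)) := by
      field_simp; ring
    rw [e1, e2]
    exact mul_le_mul_of_nonneg_left hfin (by positivity)
  have := le_of_mul_le_mul_left hfin2 (by positivity)
  rw [hKs, add_mul, one_mul]
  linarith

theorem full_estimate (h : Adm β B₀ B) (ha : Continuous a) (hα₀ : 0 < α₀)
    (haα₀ : ∀ r, α₀ ≤ a r) (haα₁ : ∀ r, a r ≤ α₁) (hf : Continuous f)
    (hs : IsSol β a z f v) (hz : 0 ≤ z.re) (hz4 : 4 ≤ ‖z‖) (hF : ∀ r, ‖f r‖ ≤ F)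
    (hV : ∀ r, ‖v r‖ ≤ V) {x₀ : ℝ} (hx₀ : x₀ ∈ Icc (0 : ℝ) 1) (hVx₀ : ‖v x₀‖ = V)
    {V₁ V₂ : ℝ} {x₁ x₂ : ℝ} (hx₁ : x₁ ∈ Icc (0 : ℝ) 1) (hx₂ : x₂ ∈ Icc (0 : ℝ) 1)
    (hV₁ : V₁ ≤ ‖prim β (fun r => (a r)⁻¹ • (z * v r - f r)) x₁‖)
    (hV₂ : V₂ ≤ ‖primDeriv β (fun r => (a r)⁻¹ • (z * v r - f r)) x₂‖) :
    ‖z‖ * V + √‖z‖ * V₁ + V₂ ≤ fullConst α₀ α₁ B * F := by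
  have hB := h.B_pos
  have hF0 : 0 ≤ F := (norm_nonneg _).trans (hF 0)
  have hα₁ : 0 < α₁ := hα₀.trans_le ((haα₀ 0).trans (haα₁ 0))
  have h0 := h.sup_estimate ha hα₀ haα₀ haα₁ hf hs hz hz4 hF hV hx₀ hVx₀
  have h1 := hV₁.trans (h.norm_first_le ha hα₀ haα₀ hf hs hz4 hF hV hx₁)
  have h2 := hV₂.trans (h.norm_second_le ha hα₀ haα₀ hf hs.cont hF hV hx₂.1)
  have hsup := one_le_supConst hα₀ hα₁ hB
  have hz0 : 0 < ‖z‖ := by linarith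
  have hs0 : 0 < √‖z‖ := Real.sqrt_pos.2 hz0
  have hss : √‖z‖ * √‖z‖ = ‖z‖ := Real.mul_self_sqrt hz0.le
  rw [fullConst]
  set C₂ := (1 + B) / α₀ with hC₂
  have hC₂0 : 0 < C₂ := by positivity
  have h3 : √‖z‖ * V₁ ≤ 2 * (‖z‖ * V) + C₂ * (‖z‖ * V + F) := by
    refine (mul_le_mul_of_nonneg_left h1 hs0.le).trans_eq ?_
    rw [mul_add, mul_div_cancel₀ _ hs0.ne']
    nth_rewrite 4 [← hss]
    ring
  nlinarith [mul_le_mul_of_nonneg_left h0 hC₂0.le, mul_nonneg hC₂0.le hF0,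
    mul_nonneg (zero_le_one.trans hsup) hF0,
    mul_nonneg hC₂0.le (mul_nonneg (zero_le_one.trans hsup) hF0)]

end Adm

/-! ### Transfer to the operator on $C([0,1])$ -/

/-- A real function on `[0,1]` as a function on `ℝ`, constant outside `[0,1]`. -/
def extR (a : C(Icc (0 : ℝ) 1, ℝ)) : ℝ → ℝ := IccExtend zero_le_one a

theorem continuous_extR (a : C(Icc (0 : ℝ) 1, ℝ)) : Continuous (extR a) :=
  a.continuous.Icc_extend'

theorem continuous_ext (v : C(Icc (0 : ℝ) 1, ℂ)) : Continuous (ext v) :=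
  v.continuous.Icc_extend'

theorem extR_of_mem (a : C(Icc (0 : ℝ) 1, ℝ)) {r : ℝ} (hr : r ∈ Icc (0 : ℝ) 1) :
    extR a r = a ⟨r, hr⟩ := IccExtend_of_mem _ _ hr

theorem ext_of_mem (a : C(Icc (0 : ℝ) 1, ℂ)) {r : ℝ} (hr : r ∈ Icc (0 : ℝ) 1) :
    ext a r = a ⟨r, hr⟩ := IccExtend_of_mem _ _ hr

theorem norm_ext_le (v : C(Icc (0 : ℝ) 1, ℂ)) (r : ℝ) : ‖ext v r‖ ≤ ‖v‖ :=
  v.norm_coe_le_norm _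

theorem exists_norm_eq (v : C(Icc (0 : ℝ) 1, ℂ)) :
    ∃ x : Icc (0 : ℝ) 1, ‖v x‖ = ‖v‖ := by
  obtain ⟨x, -, hx⟩ := isCompact_univ.exists_isMaxOn (f := fun x : Icc (0 : ℝ) 1 => ‖v x‖)
    univ_nonempty v.continuous.norm.continuousOn
  exact ⟨x, le_antisymm (v.norm_coe_le_norm x)
    ((ContinuousMap.norm_le _ (norm_nonneg _)).2 fun y => hx (mem_univ y))⟩

section C2

variable {w w₁ w₂ : ℝ → ℂ}

theorem D1_eq (hw : ∀ r ∈ Icc (0 : ℝ) 1, HasDerivWithinAt w (w₁ r) (Icc 0 1) r) {r : ℝ}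
    (hr : r ∈ Icc (0 : ℝ) 1) : D1 w r = w₁ r :=
  (hw r hr).derivWithin (uniqueDiffOn_Icc zero_lt_one r hr)

theorem D2_eq (hw : ∀ r ∈ Icc (0 : ℝ) 1, HasDerivWithinAt w (w₁ r) (Icc 0 1) r)
    (hw₁ : ∀ r ∈ Icc (0 : ℝ) 1, HasDerivWithinAt w₁ (w₂ r) (Icc 0 1) r) {r : ℝ}
    (hr : r ∈ Icc (0 : ℝ) 1) : D2 w r = w₂ r :=
  ((hw₁ r hr).congr (fun _ hx => D1_eq hw hx) (D1_eq hw hr)).derivWithin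
    (uniqueDiffOn_Icc zero_lt_one r hr)

theorem contDiffOn_two (hw : ∀ r ∈ Icc (0 : ℝ) 1, HasDerivWithinAt w (w₁ r) (Icc 0 1) r)
    (hw₁ : ∀ r ∈ Icc (0 : ℝ) 1, HasDerivWithinAt w₁ (w₂ r) (Icc 0 1) r)
    (hw₂ : ContinuousOn w₂ (Icc 0 1)) : ContDiffOn ℝ 2 w (Icc 0 1) := by
  have hu := uniqueDiffOn_Icc (zero_lt_one (α := ℝ))
  have h1 : ContDiffOn ℝ 1 w₁ (Icc 0 1) := by
    rw [show (1 : WithTop ℕ∞) = 0 + 1 from (zero_add 1).symm,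
      contDiffOn_succ_iff_derivWithin hu]
    refine ⟨fun r hr => (hw₁ r hr).differentiableWithinAt, by simp, ?_⟩
    rw [contDiffOn_zero]
    exact hw₂.congr fun r hr => (hw₁ r hr).derivWithin (hu r hr)
  rw [show (2 : WithTop ℕ∞) = 1 + 1 by norm_num, contDiffOn_succ_iff_derivWithin hu]
  exact ⟨fun r hr => (hw r hr).differentiableWithinAt, by simp,
    h1.congr fun r hr => (hw r hr).derivWithin (hu r hr)⟩

end C2

/-- Bounds for the coefficients of the principal part. -/
structure Bounds (a b : C(Icc (0 : ℝ) 1, ℝ)) (α₀ α₁ b₀ b₁ : ℝ) : Prop where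
  pos_a : 0 < α₀
  lower_a : ∀ r, α₀ ≤ a r
  upper_a : ∀ r, a r ≤ α₁
  pos_b : 0 < b₀
  lower_b : ∀ r, b₀ ≤ b r
  upper_b : ∀ r, b r ≤ b₁

/-- The quotient `b / a`. -/
def quot (a b : C(Icc (0 : ℝ) 1, ℝ)) (r : ℝ) : ℝ := extR b r / extR a r

/-- The function `h / a`. -/
def rhs (a : C(Icc (0 : ℝ) 1, ℝ)) (h : C(Icc (0 : ℝ) 1, ℂ)) (r : ℝ) : ℂ := (extR a r)⁻¹ • ext h r

/-- The principal part `a v'' + (b / r) v'`. -/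
def principal (a b : C(Icc (0 : ℝ) 1, ℝ)) (v : domL) : C(Icc (0 : ℝ) 1, ℂ) :=
  toC a * der2 v + toC b * derQ v

theorem radialOperator_apply (a b c d : C(Icc (0 : ℝ) 1, ℝ)) (v : domL) :
    radialOperator a b c d v = principal a b v + toC c * der1 v + toC d * (v : C(Icc (0 : ℝ) 1, ℂ)) := rfl

namespace Bounds

variable {a b : C(Icc (0 : ℝ) 1, ℝ)} {α₀ α₁ b₀ b₁ : ℝ}

theorem extR_pos (H : Bounds a b α₀ α₁ b₀ b₁) (r : ℝ) : 0 < extR a r :=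
  H.pos_a.trans_le (H.lower_a _)

theorem pos_a₁ (H : Bounds a b α₀ α₁ b₀ b₁) : 0 < α₁ :=
  H.pos_a.trans_le ((H.lower_a 0).trans (H.upper_a 0))

theorem adm (H : Bounds a b α₀ α₁ b₀ b₁) : Adm (quot a b) (b₀ / α₁) (b₁ / α₀) where
  cont := (continuous_extR b).div (continuous_extR a) fun r => (H.extR_pos r).ne'
  pos := div_pos H.pos_b H.pos_a₁
  lower r := div_le_div₀ (H.pos_b.le.trans (H.lower_b _)) (H.lower_b _) (H.extR_pos r)
    (H.upper_a _)
  upper _ := div_le_div₀ ((H.pos_b.le.trans (H.lower_b 0)).trans (H.upper_b 0)) (H.upper_b _)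
    H.pos_a (H.lower_a _)

theorem continuous_rhs (H : Bounds a b α₀ α₁ b₀ b₁) (h : C(Icc (0 : ℝ) 1, ℂ)) :
    Continuous (rhs a h) :=
  ((continuous_extR a).inv₀ fun r => (H.extR_pos r).ne').smul (continuous_ext h)

theorem norm_rhs_le (H : Bounds a b α₀ α₁ b₀ b₁) (h : C(Icc (0 : ℝ) 1, ℂ)) (r : ℝ) :
    ‖rhs a h r‖ ≤ α₀⁻¹ * ‖ext h r‖ := by
  rw [rhs, norm_smul, norm_inv, Real.norm_of_nonneg (H.extR_pos r).le]
  exact mul_le_mul_of_nonneg_right (inv_anti₀ H.pos_a (H.lower_a _)) (norm_nonneg _)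

theorem D2_eq_sub (H : Bounds a b α₀ α₁ b₀ b₁) (v : domL) {r : ℝ} (hr : r ∈ Icc (0 : ℝ) 1)
    (hr0 : r ≠ 0) : D2 (ext v) r =
      rhs a (principal a b v) r - (quot a b r / r) • D1 (ext v) r := by
  have ha : extR a r ≠ 0 := (H.extR_pos r).ne'
  have h1 : ext (principal a b v) r =
      extR a r * D2 (ext v) r + extR b r * (r⁻¹ • D1 (ext v) r) := by
    rw [ext_of_mem _ hr, extR_of_mem a hr, extR_of_mem b hr]
    have : derQ v ⟨r, hr⟩ = r⁻¹ • D1 (ext v) r := by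
      change DQ (ext v) r = _
      rw [DQ, if_neg hr0]
    rw [← this]
    rfl
  have ha' : (extR a r : ℂ) ≠ 0 := Complex.ofReal_ne_zero.2 ha
  have hr' : (r : ℂ) ≠ 0 := Complex.ofReal_ne_zero.2 hr0
  rw [rhs, h1, quot]
  simp only [Complex.real_smul, Complex.ofReal_div, Complex.ofReal_inv]
  field_simp
  ring

/-- This connects the operator with the integral formula: for $r>0$ it is uniqueness for the
first-order equation, and at $r=0$ it is the boundary condition. -/
theorem D1_eq_prim (H : Bounds a b α₀ α₁ b₀ b₁) (v : domL) {r : ℝ} (hr : r ∈ Icc (0 : ℝ) 1) :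
    D1 (ext v) r = prim (quot a b) (rhs a (principal a b v)) r := by
  rcases hr.1.eq_or_lt with rfl | hr0
  · rw [Adm.prim_zero]; exact v.2.2.1
  refine H.adm.eq_prim (H.continuous_rhs _) (continuousOn_D1 v.2.1) (fun s hs => ?_) ⟨hr0, hr.2⟩
  have hs' := Ioo_subset_Icc_self hs
  rw [← H.D2_eq_sub v hs' hs.1.ne']
  exact (((contDiffOn_D1 v.2.1).differentiableOn one_ne_zero) s hs').hasDerivWithinAt.hasDerivAt
    (Icc_mem_nhds hs.1 hs.2)

theorem D2_eq_primDeriv (H : Bounds a b α₀ α₁ b₀ b₁) (v : domL) {r : ℝ}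
    (hr : r ∈ Icc (0 : ℝ) 1) :
    D2 (ext v) r = primDeriv (quot a b) (rhs a (principal a b v)) r :=
  D2_eq (w₁ := prim (quot a b) (rhs a (principal a b v)))
    (fun s hs => by
      rw [← H.D1_eq_prim v hs]
      exact (v.2.1.differentiableOn two_ne_zero s hs).hasDerivWithinAt)
    (fun s hs => (H.adm.hasDerivWithinAt_prim (H.continuous_rhs _) hs.1).mono Icc_subset_Ici_self)
    hr

theorem rhs_eq (z : ℂ) (v : domL) (r : ℝ) :
    rhs a (principal a b v) r =
      (extR a r)⁻¹ • (z * ext v r - ext (z • (v : C(Icc (0 : ℝ) 1, ℂ)) - principal a b v) r) := by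
  have : ext (z • (v : C(Icc (0 : ℝ) 1, ℂ)) - principal a b v) r = z * ext v r - ext (principal a b v) r := rfl
  rw [this, sub_sub_cancel, rhs]

theorem principal_estimate (H : Bounds a b α₀ α₁ b₀ b₁) {z : ℂ} (hz : 0 ≤ z.re)
    (hz4 : 4 ≤ ‖z‖) (v : domL) :
    ‖z‖ * ‖(v : C(Icc (0 : ℝ) 1, ℂ))‖ + √‖z‖ * ‖der1 v‖ + ‖der2 v‖ ≤
      fullConst α₀ α₁ (b₁ / α₀) * ‖z • (v : C(Icc (0 : ℝ) 1, ℂ)) - principal a b v‖ := by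
  obtain ⟨x₀, hx₀⟩ := exists_norm_eq (v : C(Icc (0 : ℝ) 1, ℂ))
  obtain ⟨x₁, hx₁⟩ := exists_norm_eq (der1 v)
  obtain ⟨x₂, hx₂⟩ := exists_norm_eq (der2 v)
  have e : rhs a (principal a b v) = fun r => (extR a r)⁻¹ •
      (z * ext v r - ext (z • (v : C(Icc (0 : ℝ) 1, ℂ)) - principal a b v) r) := funext (rhs_eq z v)
  refine H.adm.full_estimate (a := extR a) (continuous_extR a) H.pos_a (fun r => H.lower_a _)
    (fun r => H.upper_a _) (continuous_ext _) (v := ext v) ⟨continuous_ext _, ?_, ?_⟩ hz hz4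
    (norm_ext_le _) (norm_ext_le _) x₀.2 ?_ x₁.2 x₂.2 ?_ ?_
  · intro r hr
    rw [← e, ← H.D1_eq_prim v hr]
    exact (v.2.1.differentiableOn two_ne_zero r hr).hasDerivWithinAt
  · rw [ext_of_mem _ ⟨zero_le_one, le_rfl⟩]; exact v.2.2.2
  · rw [ext_of_mem _ x₀.2, ← hx₀]
  · rw [← e, ← H.D1_eq_prim v x₁.2, ← hx₁]; rfl
  · rw [← e, ← H.D2_eq_primDeriv v x₂.2, ← hx₂]; rfl

/-- The perturbation of the estimate for the principal part by the lower order terms. -/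
theorem radial_estimate (H : Bounds a b α₀ α₁ b₀ b₁) {c d : C(Icc (0 : ℝ) 1, ℝ)} {m : ℝ}
    (hc : ‖c‖ ≤ m) (hd : ‖d‖ ≤ m) {z : ℂ} (hz : 0 ≤ z.re) (hz4 : 4 ≤ ‖z‖)
    (hzm : 2 * m * fullConst α₀ α₁ (b₁ / α₀) ≤ √‖z‖) (v : domL) :
    ‖z‖ * ‖(v : C(Icc (0 : ℝ) 1, ℂ))‖ + √‖z‖ * ‖der1 v‖ + ‖der2 v‖ ≤
      2 * fullConst α₀ α₁ (b₁ / α₀) * ‖z • (v : C(Icc (0 : ℝ) 1, ℂ)) - radialOperator a b c d v‖ := by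
  have hm : 0 ≤ m := (norm_nonneg _).trans hc
  have h0 := H.principal_estimate hz hz4 v
  set G := fullConst α₀ α₁ (b₁ / α₀) with hG
  have hG0 : 0 ≤ G := by
    have h1 := H.pos_a
    have h2 := H.adm.B_pos
    have := one_le_supConst H.pos_a H.pos_a₁ h2
    rw [hG, fullConst]
    positivity
  have hC : ∀ x : C(Icc (0 : ℝ) 1, ℝ), ‖x‖ ≤ m → ‖toC x‖ ≤ m := fun x hx =>
    (ContinuousMap.norm_le _ hm).2 fun r => by
      change ‖((x r : ℝ) : ℂ)‖ ≤ m
      rw [Complex.norm_real]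
      exact (x.norm_coe_le_norm r).trans hx
  have h1 : ‖z • (v : C(Icc (0 : ℝ) 1, ℂ)) - principal a b v‖ ≤
      ‖z • (v : C(Icc (0 : ℝ) 1, ℂ)) - radialOperator a b c d v‖ + (m * ‖der1 v‖ + m * ‖(v : C(Icc (0 : ℝ) 1, ℂ))‖) := by
    have e : z • (v : C(Icc (0 : ℝ) 1, ℂ)) - principal a b v = (z • (v : C(Icc (0 : ℝ) 1, ℂ)) - radialOperator a b c d v)
        + (toC c * der1 v + toC d * (v : C(Icc (0 : ℝ) 1, ℂ))) := by
      rw [radialOperator_apply]; abel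
    rw [e]
    refine (norm_add_le _ _).trans (add_le_add le_rfl ((norm_add_le _ _).trans (add_le_add ?_ ?_)))
    · exact (norm_mul_le _ _).trans (mul_le_mul_of_nonneg_right (hC c hc) (norm_nonneg _))
    · exact (norm_mul_le _ _).trans (mul_le_mul_of_nonneg_right (hC d hd) (norm_nonneg _))
  have hs2 : 2 ≤ √‖z‖ := Real.le_sqrt_of_sq_le (by norm_num; exact hz4)
  have hss : √‖z‖ * √‖z‖ = ‖z‖ := Real.mul_self_sqrt (norm_nonneg z)
  have h2 : 2 * m * G * ‖der1 v‖ ≤ √‖z‖ * ‖der1 v‖ :=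
    mul_le_mul_of_nonneg_right hzm (norm_nonneg _)
  have h3 : 2 * m * G * ‖(v : C(Icc (0 : ℝ) 1, ℂ))‖ ≤ ‖z‖ * ‖(v : C(Icc (0 : ℝ) 1, ℂ))‖ := by
    refine mul_le_mul_of_nonneg_right (hzm.trans ?_) (norm_nonneg _)
    -- Here $|z|^{1/2}\le|z|$, so the same threshold on $|z|^{1/2}$ absorbs the terms with $c$ and
    -- with $d$, each using half of the left side.
    nlinarith
  have h4 := mul_le_mul_of_nonneg_left h1 hG0
  linarith [norm_nonneg (der2 v)]

/-! ### Existence -/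

/-- The operator `h ↦ v'` for the solution of `a v'' + (b / r) v' = h`, `v'(0) = 0`. -/
def primOp (H : Bounds a b α₀ α₁ b₀ b₁) : C(Icc (0 : ℝ) 1, ℂ) →ₗ[ℂ] C(Icc (0 : ℝ) 1, ℂ) where
  toFun h := ⟨fun r => prim (quot a b) (rhs a h) r,
    (H.adm.continuous_prim (H.continuous_rhs h)).comp continuous_subtype_val⟩
  map_add' h k := by
    ext r
    change prim _ _ _ = prim _ _ _ + prim _ _ _
    have e : rhs a (h + k) = fun s => rhs a h s + rhs a k s := funext fun s => by
      simp only [rhs, ext_add, Pi.add_apply, smul_add]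
    have i : ∀ h, IntervalIntegrable (fun s => wt (quot a b) s • rhs a h s) volume 0 (r : ℝ) :=
      fun h => (H.adm.continuous_wt.smul (H.continuous_rhs h)).intervalIntegrable _ _
    simp only [prim, e, smul_add]
    rw [intervalIntegral.integral_add (i h) (i k), smul_add]
  map_smul' z h := by
    ext r
    change prim _ _ _ = z • prim _ _ _
    have e : rhs a (z • h) = fun s => z • rhs a h s := funext fun s => by
      simp only [rhs, ext_smul, Pi.smul_apply]
      rw [smul_comm]
    simp only [prim, e]
    simp only [smul_comm _ z]
    rw [intervalIntegral.integral_smul, smul_comm]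

/-- The operator `h ↦ v` for the solution of `a v'' + (b / r) v' = h`, `v'(0) = v(0) = 0`. -/
def solOp (H : Bounds a b α₀ α₁ b₀ b₁) : C(Icc (0 : ℝ) 1, ℂ) →ₗ[ℂ] C(Icc (0 : ℝ) 1, ℂ) where
  toFun h := ⟨fun r => ∫ s in (0 : ℝ)..r, ext (H.primOp h) s,
    (continuous_primitive (fun _ _ => (continuous_ext _).intervalIntegrable _ _) 0).comp
      continuous_subtype_val⟩
  map_add' h k := by
    ext r
    simp only [map_add, ext_add, ContinuousMap.coe_mk, ContinuousMap.add_apply, Pi.add_apply]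
    exact intervalIntegral.integral_add ((continuous_ext _).intervalIntegrable _ _)
      ((continuous_ext _).intervalIntegrable _ _)
  map_smul' z h := by
    ext r
    simp only [map_smul, ext_smul, ContinuousMap.coe_mk, ContinuousMap.smul_apply, Pi.smul_apply,
      RingHom.id_apply]
    exact intervalIntegral.integral_smul _ _

theorem norm_primOp_le (H : Bounds a b α₀ α₁ b₀ b₁) (h : C(Icc (0 : ℝ) 1, ℂ))
    (r : Icc (0 : ℝ) 1) : ‖H.primOp h r‖ ≤ α₀⁻¹ * ∫ s in (0 : ℝ)..r, ‖ext h s‖ := by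
  refine (H.adm.norm_prim_le_integral (H.continuous_rhs h) r.2.1).trans ?_
  rw [← intervalIntegral.integral_const_mul]
  exact integral_mono_on r.2.1 ((H.continuous_rhs h).norm.intervalIntegrable _ _)
    ((continuous_const.mul (continuous_ext h).norm).intervalIntegrable _ _)
    fun s _ => H.norm_rhs_le h s

/-- The second integration runs over a length $r\le1$ and costs nothing, so this bound has the same
form as the one for $v'$. -/
theorem norm_solOp_le (H : Bounds a b α₀ α₁ b₀ b₁) (h : C(Icc (0 : ℝ) 1, ℂ))
    (r : Icc (0 : ℝ) 1) : ‖H.solOp h r‖ ≤ α₀⁻¹ * ∫ s in (0 : ℝ)..r, ‖ext h s‖ := by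
  have hnn : 0 ≤ α₀⁻¹ * ∫ s in (0 : ℝ)..r, ‖ext h s‖ :=
    mul_nonneg (inv_nonneg.2 H.pos_a.le)
      (intervalIntegral.integral_nonneg r.2.1 fun _ _ => norm_nonneg _)
  have h1 := norm_integral_le_of_norm_le_const (a := (0 : ℝ)) (b := r)
    (f := ext (H.primOp h)) (C := α₀⁻¹ * ∫ s in (0 : ℝ)..r, ‖ext h s‖) fun s hs => by
      rw [uIoc_of_le r.2.1] at hs
      have hs' : s ∈ Icc (0 : ℝ) 1 := ⟨hs.1.le, hs.2.trans r.2.2⟩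
      rw [ext_of_mem _ hs']
      refine (H.norm_primOp_le h ⟨s, hs'⟩).trans
        (mul_le_mul_of_nonneg_left ?_ (inv_nonneg.2 H.pos_a.le))
      exact integral_mono_interval le_rfl hs.1.le hs.2
        (Eventually.of_forall fun _ => norm_nonneg _)
        ((continuous_ext h).norm.intervalIntegrable _ _)
  rw [sub_zero, abs_of_nonneg r.2.1] at h1
  exact h1.trans (mul_le_of_le_one_right hnn r.2.2)

/-- The function `α + ∫ ∫ h` as an element of `C²`. -/
theorem hasDerivWithinAt_const_add_solOp (H : Bounds a b α₀ α₁ b₀ b₁) (α : ℂ)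
    (h : C(Icc (0 : ℝ) 1, ℂ)) {r : ℝ} (hr : r ∈ Icc (0 : ℝ) 1) :
    HasDerivWithinAt (ext (ContinuousMap.const _ α + H.solOp h))
      (prim (quot a b) (rhs a h) r) (Icc 0 1) r := by
  have h1 : HasDerivAt (fun r => α + ∫ s in (0 : ℝ)..r, ext (H.primOp h) s)
      (ext (H.primOp h) r) r :=
    (integral_hasDerivAt_right ((continuous_ext _).intervalIntegrable _ _)
      ((continuous_ext _).stronglyMeasurableAtFilter _ _) (continuous_ext _).continuousAt).const_add α
  have h2 : ext (H.primOp h) r = prim (quot a b) (rhs a h) r := by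
    rw [ext_of_mem _ hr]; rfl
  rw [← h2]
  refine h1.hasDerivWithinAt.congr (fun s hs => ?_) ?_
  · rw [ext_of_mem _ hs]; rfl
  · rw [ext_of_mem _ hr]; rfl

theorem exists_domL (H : Bounds a b α₀ α₁ b₀ b₁) {α : ℂ} {h : C(Icc (0 : ℝ) 1, ℂ)}
    (hα : α + H.solOp h 1 = 0) :
    ∃ v : domL, (v : C(Icc (0 : ℝ) 1, ℂ)) = ContinuousMap.const _ α + H.solOp h ∧
      der1 v = H.primOp h ∧ principal a b v = h := by
  have hg := H.continuous_rhs h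
  have e1 : ∀ r ∈ Icc (0 : ℝ) 1, HasDerivWithinAt (ext (ContinuousMap.const _ α + H.solOp h))
      (prim (quot a b) (rhs a h) r) (Icc 0 1) r :=
    fun r hr => H.hasDerivWithinAt_const_add_solOp α h hr
  have e2 : ∀ r ∈ Icc (0 : ℝ) 1, HasDerivWithinAt (prim (quot a b) (rhs a h))
      (primDeriv (quot a b) (rhs a h) r) (Icc 0 1) r :=
    fun r hr => (H.adm.hasDerivWithinAt_prim hg hr.1).mono Icc_subset_Ici_self
  have e3 : ContDiffOn ℝ 2 (ext (ContinuousMap.const _ α + H.solOp h)) (Icc 0 1) :=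
    contDiffOn_two e1 e2 ((H.adm.continuousOn_primDeriv hg).mono Icc_subset_Ici_self)
  have hD0 : D1 (ext (ContinuousMap.const _ α + H.solOp h)) 0 = 0 := by
    rw [D1_eq e1 ⟨le_rfl, zero_le_one⟩, Adm.prim_zero]
  refine ⟨⟨ContinuousMap.const _ α + H.solOp h, e3, hD0, hα⟩, rfl, ?_, ?_⟩
  · ext r
    exact D1_eq e1 r.2
  · ext r
    have ha : ((extR a r : ℝ) : ℂ) ≠ 0 := Complex.ofReal_ne_zero.2 (H.extR_pos r).ne'
    have hab : ((extR a r : ℝ) : ℂ) + extR b r ≠ 0 := by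
      rw [← Complex.ofReal_add, Complex.ofReal_ne_zero]
      have h1 := H.extR_pos r
      have h2 : 0 < extR b r := H.pos_b.trans_le (H.lower_b _)
      positivity
    have h1 : (a r : ℂ) * D2 (ext (ContinuousMap.const _ α + H.solOp h)) r
        + b r * DQ (ext (ContinuousMap.const _ α + H.solOp h)) r = h r := by
      have ea : a r = extR a r := (extR_of_mem a r.2).symm
      have eb : b r = extR b r := (extR_of_mem b r.2).symm
      have eh : h r = ext h r := (ext_of_mem h r.2).symm
      rw [ea, eb, eh, D2_eq e1 e2 r.2, DQ, primDeriv]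
      -- At $r=0$ both $v''$ and $v'/r$ equal $(h/a)(0)/(1+\beta(0))$, and $a+b=a(1+\beta)$.
      split_ifs with h0
      · rw [D2_eq e1 e2 ⟨le_rfl, zero_le_one⟩, primDeriv, if_pos rfl, quot, rhs]
        rw [h0] at ha hab ⊢
        simp only [Complex.real_smul]
        push_cast
        field_simp
      · have h0' : ((r : ℝ) : ℂ) ≠ 0 := Complex.ofReal_ne_zero.2 h0
        rw [D1_eq e1 r.2]
        simp only [Complex.real_smul, rhs]
        generalize prim (quot a b) _ _ = P
        simp only [quot]
        push_cast
        field_simp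
        ring
    exact h1

end Bounds

/-- A lower bound and surjectivity of `z - A` give the resolvent. -/
theorem exists_isResolvent_of_surjective {X : Type*} [NormedAddCommGroup X] [NormedSpace ℂ X]
    (A : X →ₗ.[ℂ] X) {z : ℂ} {κ : ℝ} (hκ : 0 ≤ κ)
    (hle : ∀ v : A.domain, ‖(v : X)‖ ≤ κ * ‖z • (v : X) - A v‖)
    (hsurj : ∀ f : X, ∃ v : A.domain, z • (v : X) - A v = f) :
    ∃ R : X →L[ℂ] X, IsResolvent A z R ∧ ‖R‖ ≤ κ := by
  set T : A.domain →ₗ[ℂ] X := z • A.domain.subtype - A.toFun with hT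
  have hTv : ∀ v, T v = z • (v : X) - A v := fun v => rfl
  have hinj : Function.Injective T := by
    refine (injective_iff_map_eq_zero T).2 fun v hv => ?_
    have h1 := hle v
    rw [← hTv, hv, norm_zero, mul_zero] at h1
    exact Subtype.ext (norm_le_zero_iff.1 h1)
  set E := LinearEquiv.ofBijective T ⟨hinj, hsurj⟩
  set R₀ : X →ₗ[ℂ] X := A.domain.subtype ∘ₗ (E.symm : X →ₗ[ℂ] A.domain)
  have hR₀le : ∀ x, ‖R₀ x‖ ≤ κ * ‖x‖ := by
    intro x
    have h1 := hle (E.symm x)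
    rwa [← hTv, show T (E.symm x) = x from E.apply_symm_apply x] at h1
  exact ⟨R₀.mkContinuous κ hR₀le, ⟨fun x => ⟨(E.symm x).2, E.apply_symm_apply x⟩,
    fun v => congrArg Subtype.val (E.symm_apply_apply v)⟩, LinearMap.mkContinuous_norm_le _ hκ _⟩

/-! ### Solvability by a Volterra equation and shooting -/

namespace Bounds

variable {a b : C(Icc (0 : ℝ) 1, ℝ)} {α₀ α₁ b₀ b₁ : ℝ}

/-- The Volterra operator of the initial value problem for `z v - L v = f`. -/
def volterra (H : Bounds a b α₀ α₁ b₀ b₁) (p q : C(Icc (0 : ℝ) 1, ℂ)) :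
    C(Icc (0 : ℝ) 1, ℂ) →ₗ[ℂ] C(Icc (0 : ℝ) 1, ℂ) where
  toFun h := p * H.solOp h + q * H.primOp h
  map_add' h k := by simp only [map_add, mul_add]; abel
  map_smul' z h := by simp only [map_smul, mul_smul_comm, smul_add, RingHom.id_apply]

theorem norm_volterra_le (H : Bounds a b α₀ α₁ b₀ b₁) (p q h : C(Icc (0 : ℝ) 1, ℂ))
    (r : Icc (0 : ℝ) 1) :
    ‖H.volterra p q h r‖ ≤ (‖p‖ + ‖q‖) * α₀⁻¹ * ∫ s in (0 : ℝ)..r, ‖ext h s‖ := by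
  have h1 := mul_le_mul (p.norm_coe_le_norm r) (H.norm_solOp_le h r) (norm_nonneg _)
    (norm_nonneg p)
  have h2 := mul_le_mul (q.norm_coe_le_norm r) (H.norm_primOp_le h r) (norm_nonneg _)
    (norm_nonneg q)
  rw [← norm_mul] at h1 h2
  refine (norm_add_le (p r * H.solOp h r) (q r * H.primOp h r)).trans ?_
  linarith

/-- Each application integrates the previous bound over $[0,r]$ once more, which produces the
factorial. -/
theorem norm_volterra_pow_le (H : Bounds a b α₀ α₁ b₀ b₁) (p q h : C(Icc (0 : ℝ) 1, ℂ)) (n : ℕ)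
    (r : Icc (0 : ℝ) 1) :
    ‖(H.volterra p q ^ n) h r‖ ≤ ((‖p‖ + ‖q‖) * α₀⁻¹) ^ n * ‖h‖ * ((r : ℝ) ^ n / n.factorial) := by
  have hα := H.pos_a
  induction n generalizing r with
  | zero => simpa using h.norm_coe_le_norm r
  | succ n ih =>
    rw [pow_succ', Module.End.mul_apply]
    refine (H.norm_volterra_le p q _ r).trans ?_
    set k := (H.volterra p q ^ n) h with hk
    set C := (‖p‖ + ‖q‖) * α₀⁻¹ with hC
    have hC0 : 0 ≤ C := by positivity
    have h1 : ∫ s in (0 : ℝ)..r, ‖ext k s‖ ≤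
        ∫ s in (0 : ℝ)..r, C ^ n * ‖h‖ / n.factorial * s ^ n := by
      refine integral_mono_on r.2.1 ((continuous_ext k).norm.intervalIntegrable _ _)
        ((continuous_const.mul (continuous_pow n)).intervalIntegrable _ _) fun s hs => ?_
      have hs' : s ∈ Icc (0 : ℝ) 1 := ⟨hs.1, hs.2.trans r.2.2⟩
      rw [ext_of_mem _ hs']
      refine (ih ⟨s, hs'⟩).trans_eq ?_
      ring
    rw [intervalIntegral.integral_const_mul, integral_pow] at h1
    refine (mul_le_mul_of_nonneg_left h1 hC0).trans_eq ?_
    rw [Nat.factorial_succ]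
    push_cast
    field_simp
    ring

/-- Some power $K^n$ has norm below $1$, so $1-K^n$ is invertible; the factorization
$1-K^n=(1-K)\sum_{i<n}K^i$ then gives a preimage under $1-K$. -/
theorem surjective_one_sub_volterra (H : Bounds a b α₀ α₁ b₀ b₁) (p q f : C(Icc (0 : ℝ) 1, ℂ)) :
    ∃ h, h - H.volterra p q h = f := by
  have hα := H.pos_a
  set C := (‖p‖ + ‖q‖) * α₀⁻¹ with hC
  have hC0 : 0 ≤ C := by positivity
  have hlim := FloorSemiring.tendsto_pow_div_factorial_atTop C
  obtain ⟨n, hn⟩ := ((tendsto_order.1 hlim).2 (1 : ℝ) one_pos).exists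
  set K := H.volterra p q with hK
  have hKn : ∀ h, ‖(K ^ n) h‖ ≤ C ^ n / n.factorial * ‖h‖ := by
    intro h
    refine (ContinuousMap.norm_le _ (by positivity)).2 fun r => ?_
    refine (H.norm_volterra_pow_le p q h n r).trans ?_
    have : (r : ℝ) ^ n ≤ 1 := pow_le_one₀ r.2.1 r.2.2
    calc C ^ n * ‖h‖ * ((r : ℝ) ^ n / n.factorial) ≤ C ^ n * ‖h‖ * (1 / n.factorial) :=
          mul_le_mul_of_nonneg_left (div_le_div_of_nonneg_right this (by positivity))
            (by positivity)
      _ = _ := by ring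
  set T : C(Icc (0 : ℝ) 1, ℂ) →L[ℂ] C(Icc (0 : ℝ) 1, ℂ) :=
    (K ^ n).mkContinuous (C ^ n / n.factorial) hKn with hT
  have hT1 : ‖T‖ < 1 := (LinearMap.mkContinuous_norm_le _ (by positivity) _).trans_lt hn
  obtain ⟨S, hS⟩ := isUnit_one_sub_of_norm_lt_one
    (R := C(Icc (0 : ℝ) 1, ℂ) →L[ℂ] C(Icc (0 : ℝ) 1, ℂ)) hT1
  refine ⟨(∑ i ∈ Finset.range n, K ^ i) ((S⁻¹ : _ˣ).val f), ?_⟩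
  have h1 : (1 - K) * ∑ i ∈ Finset.range n, K ^ i = 1 - K ^ n := mul_neg_geom_sum K n
  have h2 : (1 - T) ((S⁻¹ : _ˣ).val f) = f := by
    rw [← hS, ← mul_apply_eq_comp, Units.mul_inv]
    rfl
  have h3 := LinearMap.congr_fun h1 ((S⁻¹ : _ˣ).val f)
  exact h3.trans h2

/-- The equation `z v - L v = f` is solvable if `z - L` is injective. -/
theorem exists_solution (H : Bounds a b α₀ α₁ b₀ b₁) (c d : C(Icc (0 : ℝ) 1, ℝ)) {z : ℂ}
    (hinj : ∀ v : domL, z • (v : C(Icc (0 : ℝ) 1, ℂ)) - radialOperator a b c d v = 0 → v = 0)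
    (f : C(Icc (0 : ℝ) 1, ℂ)) :
    ∃ v : domL, z • (v : C(Icc (0 : ℝ) 1, ℂ)) - radialOperator a b c d v = f := by
  set p : C(Icc (0 : ℝ) 1, ℂ) := ContinuousMap.const _ z - toC d with hp
  -- The unknown is the principal part $h$ of $v$. The solution with $v(0)=\alpha$ and right-hand
  -- side $\rho f$ is $h=\alpha h_1+\rho h_2$.
  obtain ⟨h₁, e₁⟩ := H.surjective_one_sub_volterra p (-toC c) p
  obtain ⟨h₂, e₂⟩ := H.surjective_one_sub_volterra p (-toC c) (-f)
  have key : ∀ (α ρ : ℂ), α + H.solOp (α • h₁ + ρ • h₂) 1 = 0 → ∃ v : domL,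
      (v : C(Icc (0 : ℝ) 1, ℂ)) = ContinuousMap.const _ α + H.solOp (α • h₁ + ρ • h₂) ∧
      z • (v : C(Icc (0 : ℝ) 1, ℂ)) - radialOperator a b c d v = ρ • f := by
    intro α ρ h1
    obtain ⟨v, hv, hv1, hv2⟩ := H.exists_domL h1
    refine ⟨v, hv, ?_⟩
    set h := α • h₁ + ρ • h₂ with hh
    have e : h - H.volterra p (-toC c) h = α • p - ρ • f := by
      ext r
      have r₁ : h₁ r - H.volterra p (-toC c) h₁ r = p r :=
        congrArg (fun g : C(Icc (0 : ℝ) 1, ℂ) => g r) e₁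
      have r₂ : h₂ r - H.volterra p (-toC c) h₂ r = -f r :=
        congrArg (fun g : C(Icc (0 : ℝ) 1, ℂ) => g r) e₂
      rw [hh, map_add, map_smul, map_smul]
      change α * h₁ r + ρ * h₂ r - (α * H.volterra p (-toC c) h₁ r +
        ρ * H.volterra p (-toC c) h₂ r) = α * p r - ρ * f r
      linear_combination α * r₁ + ρ * r₂
    have e' : h - (p * H.solOp h + -toC c * H.primOp h) = α • p - ρ • f := e
    rw [radialOperator_apply, hv1, hv2, hv]
    ext r
    have e3 : h r - (p r * H.solOp h r + -(c r : ℂ) * H.primOp h r) = α * p r - ρ * f r :=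
      congrArg (fun g : C(Icc (0 : ℝ) 1, ℂ) => g r) e'
    have e4 : p r = z - d r := rfl
    change z * (α + H.solOp h r) - (h r + (c r : ℂ) * H.primOp h r
      + (d r : ℂ) * (α + H.solOp h r)) = ρ * f r
    rw [e4] at e3
    linear_combination -e3
  -- This number is the value at $1$ of the homogeneous solution starting from $1$. If it is zero,
  -- that solution is in the domain and contradicts injectivity; otherwise $\alpha$ can be solved
  -- for.
  by_cases h0 : 1 + H.solOp h₁ 1 = 0
  · obtain ⟨v, hv, hv0⟩ := key 1 0 (by simpa using h0)
    have hvz := hinj v (hv0.trans (zero_smul ℂ f))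
    have h1 : (v : C(Icc (0 : ℝ) 1, ℂ)) 0 = 1 := by
      rw [hv]
      change (1 : ℂ) + ∫ s in (0 : ℝ)..0, _ = 1
      simp
    rw [hvz] at h1
    simp at h1
  · obtain ⟨v, -, hv⟩ := key (-H.solOp h₂ 1 / (1 + H.solOp h₁ 1)) 1 (by
      simp only [map_add, map_smul, ContinuousMap.add_apply, ContinuousMap.smul_apply, smul_eq_mul]
      field_simp
      ring)
    exact ⟨v, by simpa using hv⟩

theorem exists_isResolvent (H : Bounds a b α₀ α₁ b₀ b₁) (c d : C(Icc (0 : ℝ) 1, ℝ)) {z : ℂ}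
    {κ : ℝ} (hκ : 0 ≤ κ)
    (hle : ∀ v : domL, ‖(v : C(Icc (0 : ℝ) 1, ℂ))‖ ≤
      κ * ‖z • (v : C(Icc (0 : ℝ) 1, ℂ)) - radialOperator a b c d v‖) :
    ∃ R : C(Icc (0 : ℝ) 1, ℂ) →L[ℂ] C(Icc (0 : ℝ) 1, ℂ),
      IsResolvent (radialOperator a b c d) z R ∧ ‖R‖ ≤ κ := by
  refine exists_isResolvent_of_surjective _ hκ hle (H.exists_solution c d fun v hv => ?_)
  have h1 := hle v
  rw [hv, norm_zero, mul_zero] at h1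
  exact Subtype.ext (norm_le_zero_iff.1 h1)

end Bounds

/-! ### From a half plane to a sector -/

theorem neg_re_le_of_abs_arg_lt {w : ℂ} {k : ℝ} (h : |Complex.arg w| < Real.pi / 2 + Real.arctan k) (hw : w.re < 0) : -w.re ≤ k * |w.im| := by
  have h1 : Real.pi / 2 < |Complex.arg w| := by
    by_contra! h2
    exact absurd (Complex.abs_arg_le_pi_div_two_iff.1 h2) (not_le.2 hw)
  set t := |Complex.arg w| - Real.pi / 2 with ht
  have ht0 : 0 < t := by linarith
  have htk : t < Real.arctan k := by linarith
  have ht2 : t < Real.pi / 2 := htk.trans (Real.arctan_lt_pi_div_two k)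
  have hcos : 0 < Real.cos t := Real.cos_pos_of_mem_Ioo ⟨by linarith [Real.pi_pos], ht2⟩
  have e : |Complex.arg w| = t + Real.pi / 2 := by rw [ht]; ring
  have hre : w.re = -(‖w‖ * Real.sin t) := by
    rw [← Complex.norm_mul_cos_arg, ← Real.cos_abs, e, Real.cos_add_pi_div_two]; ring
  have him : |w.im| = ‖w‖ * Real.cos t := by
    rw [← Complex.norm_mul_sin_arg, abs_mul, abs_norm]
    congr 1
    rcases abs_choice (Complex.arg w) with h | h
    · rw [← h, e, Real.sin_add_pi_div_two, abs_of_pos hcos]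
    · have : Complex.arg w = -(t + Real.pi / 2) := by linarith
      rw [this, Real.sin_neg, abs_neg, Real.sin_add_pi_div_two, abs_of_pos hcos]
  have htan : Real.sin t ≤ k * Real.cos t := by
    rw [← div_le_iff₀ hcos, ← Real.tan_eq_sin_div_cos, ← Real.tan_arctan k]
    exact (Real.strictMonoOn_tan.lt_iff_lt ⟨by linarith [Real.pi_pos], ht2⟩
      ⟨Real.neg_pi_div_two_lt_arctan k, Real.arctan_lt_pi_div_two k⟩).2 htk |>.le
  rw [hre, him, neg_neg]
  calc ‖w‖ * Real.sin t ≤ ‖w‖ * (k * Real.cos t) := mul_le_mul_of_nonneg_left htan (norm_nonneg _)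
    _ = _ := by ring

/-- An a priori estimate in a half plane, together with solvability wherever an a priori estimate
holds, implies sectoriality. -/
theorem isSectorial_of_estimate {X : Type*} [NormedAddCommGroup X] [NormedSpace ℂ X]
    (A : X →ₗ.[ℂ] X) {ω C : ℝ} (hω : 0 ≤ ω) (hC : 0 < C)
    (hle : ∀ z : ℂ, ω ≤ z.re → ∀ v : A.domain, ‖z‖ * ‖(v : X)‖ ≤ C * ‖z • (v : X) - A v‖)
    (hres : ∀ (z : ℂ) (κ : ℝ), 0 ≤ κ → (∀ v : A.domain, ‖(v : X)‖ ≤ κ * ‖z • (v : X) - A v‖) →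
      ∃ R : X →L[ℂ] X, IsResolvent A z R ∧ ‖R‖ ≤ κ) : IsSectorial A := by
  -- The slope is small enough that a horizontal shift by $k|\mathrm{Im}\,z|$ perturbs the estimate
  -- by at most half of its left side.
  set k : ℝ := (2 * C + 1)⁻¹ with hk
  have hk0 : 0 < k := by positivity
  have hk1 : k ≤ 1 := inv_le_one_of_one_le₀ (by linarith)
  have hkC : 2 * C * k ≤ 1 := by
    rw [hk, ← div_eq_mul_inv, div_le_one (by positivity)]; linarith
  refine ⟨ω, Real.pi / 2 + Real.arctan k, 4 * C, by linarith [Real.arctan_pos.2 hk0],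
    by linarith [Real.arctan_lt_pi_div_two k], by positivity, fun z hz harg => ?_⟩
  have hzω : 0 < ‖z - ω‖ := norm_pos_iff.2 (sub_ne_zero.2 hz)
  refine hres z _ (by positivity) fun v => ?_
  rw [div_mul_eq_mul_div, le_div_iff₀ hzω]
  rcases le_or_gt ω z.re with hre | hre
  · have h1 : ‖z - ω‖ ≤ ‖z‖ := by
      rw [← sq_le_sq₀ (norm_nonneg _) (norm_nonneg _), ← Complex.normSq_eq_norm_sq,
        ← Complex.normSq_eq_norm_sq, Complex.normSq_apply, Complex.normSq_apply]
      simp only [Complex.sub_re, Complex.sub_im, Complex.ofReal_re, Complex.ofReal_im]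
      nlinarith
    nlinarith [hle z hre v, mul_le_mul_of_nonneg_left h1 (norm_nonneg (v : X)),
      mul_nonneg hC.le (norm_nonneg (z • (v : X) - A v))]
  · set y : ℂ := ⟨ω, z.im⟩ with hy
    have hw := neg_re_le_of_abs_arg_lt harg (by simpa using hre)
    simp only [Complex.sub_re, Complex.sub_im, Complex.ofReal_re, Complex.ofReal_im,
      sub_zero] at hw
    have him : |z.im| ≤ ‖y‖ := Complex.abs_im_le_norm y
    have hyz : ‖y - z‖ ≤ k * |z.im| := by
      have e : y - z = ((ω - z.re : ℝ) : ℂ) := by apply Complex.ext <;> simp [hy]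
      rw [e, Complex.norm_real, Real.norm_of_nonneg (by linarith)]
      linarith
    have hzω' : ‖z - ω‖ ≤ 2 * ‖y‖ := by
      refine (Complex.norm_le_abs_re_add_abs_im _).trans ?_
      simp only [Complex.sub_re, Complex.sub_im, Complex.ofReal_re, Complex.ofReal_im, sub_zero]
      rw [abs_of_neg (by linarith)]
      nlinarith [abs_nonneg z.im]
    have h1 := hle y le_rfl v
    have h2 : ‖y • (v : X) - A v‖ ≤ ‖z • (v : X) - A v‖ + ‖y - z‖ * ‖(v : X)‖ := by
      have e : y • (v : X) - A v = (z • (v : X) - A v) + (y - z) • (v : X) := by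
        rw [sub_smul]; abel
      rw [e, ← norm_smul]
      exact norm_add_le _ _
    have h3 : C * (‖y - z‖ * ‖(v : X)‖) ≤ ‖y‖ * ‖(v : X)‖ / 2 := by
      have h4 : C * ‖y - z‖ ≤ ‖y‖ / 2 := by
        have h5 : C * ‖y - z‖ ≤ C * (k * ‖y‖) := by
          refine mul_le_mul_of_nonneg_left (hyz.trans ?_) hC.le
          exact mul_le_mul_of_nonneg_left him hk0.le
        nlinarith [norm_nonneg y]
      nlinarith [norm_nonneg (v : X)]
    nlinarith [mul_le_mul_of_nonneg_left h2 hC.le,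
      mul_le_mul_of_nonneg_left hzω' (norm_nonneg (v : X))]

/-! ### Constants depending on $M$ and the conclusion -/

/-- The constant in the resolvent estimate, as a function of the bound for the coefficients. -/
def resolventConst (M : ℝ) : ℝ :=
  4 + 2 * |fullConst M⁻¹ M (M / M⁻¹)| + (2 * M * fullConst M⁻¹ M (M / M⁻¹)) ^ 2

theorem one_lt_resolventConst (M : ℝ) : 1 < resolventConst M := by
  have := abs_nonneg (fullConst M⁻¹ M (M / M⁻¹))
  have := sq_nonneg (2 * M * fullConst M⁻¹ M (M / M⁻¹))
  rw [resolventConst]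
  linarith

theorem exists_pos_le_iInf (a : C(Icc (0 : ℝ) 1, ℝ)) (ha : ∀ r, 0 < a r) :
    0 < ⨅ r, a r ∧ ∀ r, ⨅ r, a r ≤ a r := by
  obtain ⟨x, -, hx⟩ := isCompact_univ.exists_isMinOn univ_nonempty a.continuous.continuousOn
  have hb : BddBelow (range a) := ⟨a x, by rintro _ ⟨y, rfl⟩; exact hx (mem_univ y)⟩
  exact ⟨(ha x).trans_le (le_ciInf fun y => hx (mem_univ y)), fun r => ciInf_le hb r⟩

theorem bounds_of_pos {a b c d : C(Icc (0 : ℝ) 1, ℝ)} (ha : ∀ r, 0 < a r) (hb : ∀ r, 0 < b r) :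
    let M := coeffBound a b c d
    Bounds a b M⁻¹ M M⁻¹ M ∧ ‖c‖ ≤ M ∧ ‖d‖ ≤ M := by
  intro M
  obtain ⟨ha0, ha1⟩ := exists_pos_le_iInf a ha
  obtain ⟨hb0, hb1⟩ := exists_pos_le_iInf b hb
  have ha2 := inv_pos.2 ha0
  have hb2 := inv_pos.2 hb0
  have na := norm_nonneg a
  have nb := norm_nonneg b
  have nc := norm_nonneg c
  have nd := norm_nonneg d
  have hM : M = (⨅ r, a r)⁻¹ + (⨅ r, b r)⁻¹ + ‖a‖ + ‖b‖ + ‖c‖ + ‖d‖ := rfl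
  have hM0 : 0 < M := by rw [hM]; positivity
  refine ⟨⟨inv_pos.2 hM0, fun r => ?_, fun r => ?_, inv_pos.2 hM0, fun r => ?_, fun r => ?_⟩,
    by linarith, by linarith⟩
  · refine le_trans ?_ (ha1 r)
    rw [inv_le_comm₀ hM0 ha0]
    linarith
  · have := (le_abs_self _).trans (a.norm_coe_le_norm r)
    linarith
  · refine le_trans ?_ (hb1 r)
    rw [inv_le_comm₀ hM0 hb0]
    linarith
  · have := (le_abs_self _).trans (b.norm_coe_le_norm r)
    linarith

theorem radialOperator_estimate {a b c d : C(Icc (0 : ℝ) 1, ℝ)} (ha : ∀ r, 0 < a r)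
    (hb : ∀ r, 0 < b r) {z : ℂ} (hz : resolventConst (coeffBound a b c d) ≤ z.re) (v : domL) :
    ‖z‖ * ‖(v : C(Icc (0 : ℝ) 1, ℂ))‖ + √‖z‖ * ‖der1 v‖ + ‖der2 v‖ ≤
      resolventConst (coeffBound a b c d) *
        ‖z • (v : C(Icc (0 : ℝ) 1, ℂ)) - radialOperator a b c d v‖ := by
  obtain ⟨H, hc, hd⟩ := bounds_of_pos (c := c) (d := d) ha hb
  set M := coeffBound a b c d
  set G := fullConst M⁻¹ M (M / M⁻¹) with hG
  have hC : resolventConst M = 4 + 2 * |G| + (2 * M * G) ^ 2 := rfl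
  have hzn := hz.trans (Complex.re_le_norm z)
  have hG' := abs_nonneg G
  have hsq := sq_nonneg (2 * M * G)
  -- The summand $4$ of the constant secures $|z|\ge4$, the square secures $|z|^{1/2}\ge2MG$, and
  -- $2|G|$ dominates the constant of the estimate.
  refine (H.radial_estimate hc hd (by linarith) (by linarith)
    (Real.le_sqrt_of_sq_le (by linarith)) v).trans
    (mul_le_mul_of_nonneg_right ?_ (norm_nonneg _))
  linarith [le_abs_self G]

theorem radialOperator_isSectorial {a b c d : C(Icc (0 : ℝ) 1, ℝ)} (ha : ∀ r, 0 < a r)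
    (hb : ∀ r, 0 < b r) : IsSectorial (radialOperator a b c d) := by
  obtain ⟨H, -, -⟩ := bounds_of_pos (c := c) (d := d) ha hb
  have hC := one_lt_resolventConst (coeffBound a b c d)
  refine isSectorial_of_estimate (radialOperator a b c d)
    (ω := resolventConst (coeffBound a b c d)) (by linarith) (by linarith) (fun z hz v => ?_)
    fun z κ hκ h => H.exists_isResolvent c d hκ h
  have h1 := radialOperator_estimate ha hb hz v
  have h2 : 0 ≤ √‖z‖ * ‖der1 v‖ := by positivity
  have h3 : 0 ≤ ‖der2 v‖ := norm_nonneg _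
  linarith

/-- Ellipticity: $u_0>0$ keeps $j$ away from zero, and $p>1$ gives the square $(u+rw)^2$ a positive
factor. -/
theorem coeffA_pos {p : ℝ} (hp : 1 < p) {u₀ : ℝ → ℝ} (h : IsDatum u₀) (r : Icc (0 : ℝ) 1) :
    0 < coeffA p h r := by
  have hu := h.pos r r.2
  change 0 < aFun p r (u₀ r) (D1 u₀ r)
  have hp' : 0 < p - 1 := by linarith
  have := Real.rpow_pos_of_pos (jFun_pos r (u₀ r) (D1 u₀ r) hu) ((p - 4) / 2)
  rw [aFun]
  positivity

theorem coeffB_pos {p : ℝ} (hp : 1 < p) {u₀ : ℝ → ℝ} (h : IsDatum u₀) (r : Icc (0 : ℝ) 1) :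
    0 < coeffB p h r := by
  have hu := h.pos r r.2
  change 0 < bFun p r (u₀ r) (D1 u₀ r)
  have hp' : 0 < p := by linarith
  have := Real.rpow_pos_of_pos (jFun_pos r (u₀ r) (D1 u₀ r) hu) ((p - 4) / 2)
  rw [bFun]
  positivity

end PHarmonicFlow

end

theorem mainTheorem8 :
    ∃ C : ℝ → ℝ, (∀ M : ℝ, 1 < C M) ∧
      ∀ (p : ℝ), 1 < p → p < 2 →
      ∀ (u₀ : ℝ → ℝ) (hu₀ : PHarmonicFlow.IsDatum u₀),
        PHarmonicFlow.IsSectorial (PHarmonicFlow.linearizedOperator p hu₀) ∧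
        ∀ z : ℂ, C (PHarmonicFlow.linearizedBound p hu₀) ≤ z.re →
          ∀ v : (PHarmonicFlow.linearizedOperator p hu₀).domain,
            ‖z‖ * ‖(v : C(Set.Icc (0 : ℝ) 1, ℂ))‖
                + ‖z‖ ^ (1 / 2 : ℝ) * ‖PHarmonicFlow.der1 v‖ + ‖PHarmonicFlow.der2 v‖ ≤
              C (PHarmonicFlow.linearizedBound p hu₀) *
                ‖z • (v : C(Set.Icc (0 : ℝ) 1, ℂ)) - PHarmonicFlow.linearizedOperator p hu₀ v‖ := by
  refine ⟨PHarmonicFlow.resolventConst, PHarmonicFlow.one_lt_resolventConst,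
    fun p hp _ u₀ hu₀ => ⟨PHarmonicFlow.radialOperator_isSectorial
      (PHarmonicFlow.coeffA_pos hp hu₀) (PHarmonicFlow.coeffB_pos hp hu₀), fun z hz v => ?_⟩⟩
  rw [← Real.sqrt_eq_rpow]
  exact PHarmonicFlow.radialOperator_estimate (PHarmonicFlow.coeffA_pos hp hu₀)
    (PHarmonicFlow.coeffB_pos hp hu₀) hz v
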